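/- Let $f:\mathbb{R}\to\mathbb{C}$ be a centred complex Gaussian stationary process with almost surely continuously differentiable sample paths; that is, every vector $(f(t_1),\dots,f(t_n))$ has the law of $A\mathbf v$, where $A$ is a complex matrix and the entries of $\mathbf v$ are i.i.d. with density $\frac1\pi e^{-|z|^2}$ on $\mathbb{C}$, and these laws are invariant under real shifts. Suppose that its covariance kernel $r(t)=\mathbb{E}[f(t)\overline{f(0)}]$ satisfies $r(t)=\int_{\mathbb{R}}e^{-it\lambda}\,d\rho(\lambda)$ for all $t\in\mathbb{R}$, where the spectral measure $\rho$ is a probability measure on $\mathbb{R}$ (so $r(0)=1$) which is not a unit mass at a single point and satisfies, for some $\alpha>0$, $$\int_{\mathbb{R}}\lambda^2\log^{1+\alpha}(1+|\lambda|)\,d\rho(\lambda)<\infty .$$ For $T>0$ let $$\Delta(T)=\frac1{2i}\int_0^T\left[\frac{f'(t)}{f(t)}-\overline{\left(\frac{f'(t)}{f(t)}\right)}\right]dt$$ be the winding of $f$ around the origin in the interval $[0,T]$. Then there exist $C>0$ and $T_0>0$, depending only on $r$, such that for all $T\ge T_0$ the random variable $\Delta(T)$ is square-integrable and $$\operatorname{Var}[\Delta(T)]\ge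 C\,T .$$ -/

import Mathlib

open MeasureTheory ProbabilityTheory
open scoped Matrix ComplexConjugate

/-- The standard complex Gaussian distribution: density `π⁻¹ exp (-|z|²)` on `ℂ`. -/
noncomputable def stdComplexGaussian : Measure ℂ :=
  (volume : Measure ℂ).withDensity
    (fun z => ENNReal.ofReal (Real.pi⁻¹ * Real.exp (-‖z‖ ^ 2)))

/-- `X` is a (centred) complex Gaussian vector: its law is the law of `A v`, where the entries
of `v` are i.i.d. standard complex Gaussians and `A` is a complex matrix. -/
def IsComplexGaussianVector {Ω : Type*} [MeasurableSpace Ω] {n : ℕ}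
    (X : Ω → Fin n → ℂ) (P : Measure Ω) : Prop :=
  AEMeasurable X P ∧
    ∃ (m : ℕ) (A : Matrix (Fin n) (Fin m) ℂ),
      P.map X = (Measure.pi (fun _ : Fin m => stdComplexGaussian)).map (fun v => A *ᵥ v)

/-- `f` is a (centred) complex Gaussian stationary process on `ℝ`: all finite marginals are
complex Gaussian vectors, and their laws are invariant under real shifts. -/
structure IsGSP {Ω : Type*} [MeasurableSpace Ω] (f : ℝ → Ω → ℂ) (P : Measure Ω) : Prop where
  gaussian : ∀ (n : ℕ) (t : Fin n → ℝ), IsComplexGaussianVector (fun ω i => f (t i) ω) P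
  stationary : ∀ (n : ℕ) (t : Fin n → ℝ) (s : ℝ),
    P.map (fun ω i => f (t i + s) ω) = P.map (fun ω i => f (t i) ω)

/-- The covariance kernel `r(t) = E[f(t) conj (f(0))]`. -/
noncomputable def covarianceKernel {Ω : Type*} [MeasurableSpace Ω]
    (f : ℝ → Ω → ℂ) (P : Measure Ω) (t : ℝ) : ℂ :=
  ∫ ω, f t ω * conj (f 0 ω) ∂P

/-- `ρ` is the spectral measure of the (normalized, `r(0) = 1`) covariance kernel `r`:
a probability measure with `r(t) = ∫ exp (-i t l) dρ(l)`. -/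
def IsSpectralMeasure (r : ℝ → ℂ) (ρ : Measure ℝ) : Prop :=
  IsProbabilityMeasure ρ ∧
    ∀ t : ℝ, r t = ∫ l : ℝ, Complex.exp (-Complex.I * (t : ℂ) * (l : ℂ)) ∂ρ

/-- The log-moment condition: `∫ l² log^(1+α) (1+|l|) dρ(l) < ∞` for some `α > 0`. -/
def LogMomentCondition (ρ : Measure ℝ) : Prop :=
  ∃ α : ℝ, 0 < α ∧
    Integrable (fun l : ℝ => l ^ 2 * Real.log (1 + |l|) ^ (1 + α)) ρ

/-- Degenerate spectral measure: a unit mass at one point. -/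
def IsDegenerate (ρ : Measure ℝ) : Prop :=
  ∃ φ : ℝ, ρ = Measure.dirac φ

/-- The winding (increment of the argument) of a path `g` around the origin on `[0, T]`:
`∫₀ᵀ Im (g'(t) / g(t)) dt`. -/
noncomputable def winding (g : ℝ → ℂ) (T : ℝ) : ℝ :=
  ∫ t in (0 : ℝ)..T, (deriv g t / g t).im

/-- The winding as `(2i)⁻¹ ∫₀ᵀ [g'/g - conj (g'/g)] dt`. -/
theorem winding_eq (g : ℝ → ℂ) (T : ℝ) :
    (winding g T : ℂ) =
      1 / (2 * Complex.I) * ∫ t in (0 : ℝ)..T, (deriv g t / g t - conj (deriv g t / g t)) := by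
  have h : ∀ z : ℂ, z - conj z = (2 * Complex.I) * ((z.im : ℝ) : ℂ) := by
    intro z
    rw [Complex.sub_conj]
    push_cast
    ring
  simp only [h]
  rw [intervalIntegral.integral_const_mul, intervalIntegral.integral_ofReal, winding,
    ← mul_assoc, one_div, inv_mul_cancel₀, one_mul]
  simp

/-!
The winding is the time integral of `Im (f' / f)`. Compare it with the integral `Q` of
`Im (conj f * (f' + i φ f))`, where `φ` is the mean of `ρ`. At a fixed time `f' + i φ f` is
independent of `f`, and both `1 / f` and `conj f` have the phase of `f⁻¹` and satisfy
`E[f⁻¹ f] = E[conj f * f] = 1`; Gaussian integration sees nothing else, so that the winding and `Q`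
have the same covariance with `Q`. Hence `Var Δ ≥ Var Q`, and `Var Q` is a double spectral integral
of `(x + y - 2 φ) ^ 2` against the Fejér kernel of `x - y`, which grows linearly in `T` as soon as
`ρ` charges a point other than `φ`.

Square integrability of the winding rests on `E |f'(s) f'(t) / (f(s) f(t))| ≲ 1 + |s - t| ^ (-3/5)`
for nearby times. The finiteness of `∫ l ^ 2 dρ` comes from the paths: the difference quotients of
`f` at a point are Gaussian and converge almost surely, hence their variances stay bounded.
-/

open Filter Topology

theorem integral_stdComplexGaussian {F : Type*} [NormedAddCommGroup F] [NormedSpace ℝ F]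
    (g : ℂ → F) :
    ∫ z, g z ∂stdComplexGaussian = ∫ z : ℂ, (Real.pi⁻¹ * Real.exp (-‖z‖ ^ 2)) • g z := by
  rw [stdComplexGaussian,
    integral_withDensity_eq_integral_toReal_smul (by fun_prop) (by simp)]
  refine integral_congr_ae (.of_forall fun z => ?_)
  simp only [ENNReal.toReal_ofReal (show 0 ≤ Real.pi⁻¹ * Real.exp (-‖z‖ ^ 2) by positivity)]

theorem integral_norm_rpow_stdComplexGaussian {q : ℝ} (hq : -2 < q) :
    ∫ z : ℂ, ‖z‖ ^ q ∂stdComplexGaussian = Real.Gamma (q / 2 + 1) := by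
  have h := Complex.integral_rpow_mul_exp_neg_rpow (p := 2) (q := q) (by norm_num) hq
  simp only [Real.rpow_two] at h
  simp_rw [integral_stdComplexGaussian, smul_eq_mul, mul_assoc, mul_comm (Real.exp _)]
  rw [integral_const_mul, h, add_div]
  field_simp

theorem integrable_norm_rpow_stdComplexGaussian {q : ℝ} (hq : -2 < q) :
    Integrable (fun z : ℂ => ‖z‖ ^ q) stdComplexGaussian := by
  refine not_imp_comm.1 integral_undef ?_
  rw [integral_norm_rpow_stdComplexGaussian hq]
  exact (Real.Gamma_pos_of_pos (by linarith)).ne'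

instance isProbabilityMeasure_stdComplexGaussian :
    IsProbabilityMeasure stdComplexGaussian := by
  have h := integral_norm_rpow_stdComplexGaussian (q := 0) (by norm_num)
  simpa [isProbabilityMeasure_iff_real] using h

theorem ae_ne_zero_stdComplexGaussian : ∀ᵐ z ∂stdComplexGaussian, z ≠ 0 :=
  (withDensity_absolutelyContinuous _ _).ae_le (volume.ae_ne 0)

theorem integral_norm_sq_stdComplexGaussian :
    ∫ z : ℂ, ‖z‖ ^ 2 ∂stdComplexGaussian = 1 := by
  simpa [one_add_one_eq_two] using integral_norm_rpow_stdComplexGaussian (q := 2) (by norm_num)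

theorem memLp_id_stdComplexGaussian {q : ENNReal} (hq : q ≠ ⊤) :
    MemLp (fun z : ℂ => z) q stdComplexGaussian := by
  rcases eq_or_ne q 0 with rfl | h0
  · exact memLp_zero_iff_aestronglyMeasurable.2 (by fun_prop)
  · rw [← integrable_norm_rpow_iff (by fun_prop) h0 hq]
    exact integrable_norm_rpow_stdComplexGaussian
      (by linarith [ENNReal.toReal_nonneg (a := q)])

theorem charFun_stdComplexGaussian (t : ℂ) :
    charFun stdComplexGaussian t = Complex.exp (-(‖t‖ ^ 2 : ℝ) / 4) := by
  have h := GaussianFourier.integral_cexp_neg_mul_sq_norm_add (V := ℂ) (b := 1)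
    (by simp) Complex.I t
  have hexp : ∀ z : ℂ,
      (Real.pi⁻¹ * Real.exp (-‖z‖ ^ 2)) • Complex.exp ((inner ℝ z t : ℝ) * Complex.I) =
        (Real.pi⁻¹ : ℂ) *
          Complex.exp (-1 * (‖z‖ : ℂ) ^ 2 + Complex.I * (inner ℝ t z : ℝ)) := by
    intro z
    rw [Complex.exp_add, real_inner_comm, Complex.real_smul, mul_comm Complex.I]
    push_cast
    ring_nf
  simp only [charFun_apply, integral_stdComplexGaussian, hexp]
  rw [integral_const_mul, h]
  simp [Complex.I_sq]

theorem measurePreserving_mul_stdComplexGaussian {c : ℂ} (hc : ‖c‖ = 1) :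
    MeasurePreserving (fun z => c * z) stdComplexGaussian stdComplexGaussian := by
  refine ⟨by fun_prop, Measure.ext_of_charFun (funext fun t => ?_)⟩
  have hinner : ∀ z : ℂ, inner ℝ (c * z) t = inner ℝ z (conj c * t) := by
    intro z
    simp only [Complex.inner, map_mul]
    ring_nf
  rw [charFun_apply, integral_map (by fun_prop) (by fun_prop)]
  simp only [hinner]
  rw [← charFun_apply (E := ℂ), charFun_stdComplexGaussian, charFun_stdComplexGaussian]
  simp [hc]

theorem integral_stdComplexGaussian_eq_zero_of_rotation {g : ℂ → ℂ} {c d : ℂ} (hc : ‖c‖ = 1)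
    (hd : d ≠ 1) (hg : ∀ z, g (c * z) = d * g z) : ∫ z, g z ∂stdComplexGaussian = 0 := by
  have hc0 : c ≠ 0 := norm_ne_zero_iff.1 (hc ▸ one_ne_zero)
  have h : d * ∫ z, g z ∂stdComplexGaussian = ∫ z, g z ∂stdComplexGaussian := by
    rw [← integral_const_mul, ← (measurePreserving_mul_stdComplexGaussian hc).integral_comp
      (MeasurableEquiv.mulLeft₀ c hc0).measurableEmbedding g]
    simp only [hg]
  exact (mul_left_eq_self₀.1 h).resolve_left hd

section SquareIntegrable

variable {α : Type*} [MeasurableSpace α] {μ : Measure α} {f g : α → ℂ}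

theorem integrable_mul_conj (hf : MemLp f 2 μ) (hg : MemLp g 2 μ) :
    Integrable (fun x => f x * conj (g x)) μ :=
  hf.integrable_mul hg.star

theorem integral_norm_add_sq (hf : MemLp f 2 μ) (hg : MemLp g 2 μ) :
    ∫ x, ‖f x + g x‖ ^ 2 ∂μ = ∫ x, ‖f x‖ ^ 2 ∂μ + ∫ x, ‖g x‖ ^ 2 ∂μ
      + 2 * (∫ x, f x * conj (g x) ∂μ).re := by
  have hf2 := hf.integrable_norm_pow two_ne_zero
  have hg2 := hg.integrable_norm_pow two_ne_zero
  have hfg := integrable_mul_conj hf hg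
  simp only [Complex.sq_norm, Complex.normSq_add] at hf2 hg2 ⊢
  have hfg2 : Integrable (fun x => 2 * (f x * conj (g x)).re) μ := hfg.re.const_mul 2
  have hre : ∫ x, (f x * conj (g x)).re ∂μ = (∫ x, f x * conj (g x) ∂μ).re := integral_re hfg
  rw [integral_add (hf2.fun_add hg2) hfg2, integral_add hf2 hg2, integral_const_mul, hre]

end SquareIntegrable

section RealFunctional

theorem exists_eq_re_mul (L : ℂ →L[ℝ] ℝ) : ∃ a : ℂ, ∀ z, L z = (a * z).re :=
  ⟨conj ((InnerProductSpace.toDual ℝ ℂ).symm L), fun z => by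
    rw [mul_comm, ← Complex.inner, InnerProductSpace.toDual_symm_apply]⟩

theorem exists_eq_re_sum_mul {ι : Type*} [Fintype ι] (L : (ι → ℂ) →L[ℝ] ℝ) :
    ∃ b : ι → ℂ, ∀ w, L w = (∑ i, b i * w i).re := by
  classical
  choose b hb using fun i => exists_eq_re_mul (L.comp (.single ℝ (fun _ : ι => ℂ) i))
  refine ⟨b, fun w => ?_⟩
  conv_lhs => rw [← Finset.univ_sum_single w, map_sum]
  rw [Complex.re_sum]
  exact Finset.sum_congr rfl fun i _ => hb i (w i)

end RealFunctional

section GaussianLaw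

variable {Ω : Type*} [MeasurableSpace Ω] {P : Measure Ω} {Y : Ω → ℂ} {σ : ℝ}

theorem charFun_map_smul_stdComplexGaussian (σ : ℝ) (t : ℂ) :
    charFun (stdComplexGaussian.map (fun z => σ • z)) t =
      Complex.exp (-(‖t‖ ^ 2 * σ ^ 2 : ℝ) / 4) := by
  rw [charFun_map_smul, charFun_stdComplexGaussian, norm_smul, mul_pow, Real.norm_eq_abs, sq_abs,
    mul_comm]

theorem memLp_of_map_eq_smul (hY : AEMeasurable Y P)
    (h : P.map Y = stdComplexGaussian.map (fun z => σ • z)) {q : ENNReal} (hq : q ≠ ⊤) :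
    MemLp Y q P := by
  refine (memLp_map_measure_iff (g := id) (by fun_prop) hY).1 ?_
  rw [h, memLp_map_measure_iff (by fun_prop) (by fun_prop)]
  exact (memLp_id_stdComplexGaussian hq).const_smul σ

theorem integral_norm_sq_of_map_eq_smul (hY : AEMeasurable Y P)
    (h : P.map Y = stdComplexGaussian.map (fun z => σ • z)) : ∫ ω, ‖Y ω‖ ^ 2 ∂P = σ ^ 2 := by
  rw [← integral_map (f := fun z : ℂ => ‖z‖ ^ 2) hY (by fun_prop), h,
    integral_map (by fun_prop) (by fun_prop)]
  simp only [norm_smul, mul_pow, Real.norm_eq_abs, sq_abs]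
  rw [integral_const_mul, integral_norm_sq_stdComplexGaussian, mul_one]

theorem integral_exp_re_of_map_eq_smul (hY : AEMeasurable Y P)
    (h : P.map Y = stdComplexGaussian.map (fun z => σ • z)) :
    ∫ ω, Complex.exp ((Y ω).re * Complex.I) ∂P =
      Complex.exp (-(∫ ω, ‖Y ω‖ ^ 2 ∂P : ℝ) / 4) := by
  have hchar : ∫ ω, Complex.exp ((Y ω).re * Complex.I) ∂P = charFun (P.map Y) 1 := by
    rw [charFun_apply, integral_map hY (by fun_prop)]
    simp [Complex.inner]
  rw [hchar, h, charFun_map_smul_stdComplexGaussian, integral_norm_sq_of_map_eq_smul hY h]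
  simp

end GaussianLaw

section Isonormal

variable {Ω E : Type*} [MeasurableSpace Ω] [MeasurableSpace E]

/-- A complex isonormal Gaussian family over `L²(ρ)`, encoded as a linear relation `S` between
random variables and square-integrable functions: whenever `S` relates `X` to `h`, the variable
`X` is centred circularly symmetric complex Gaussian with `E|X|² = ∫ |h|² dρ`. Since `S` is stable
under complex scalars, prescribing `E exp (i Re X)` prescribes the whole law of `X`. -/
structure IsIsonormal (P : Measure Ω) (ρ : Measure E)
    (S : Submodule ℂ ((Ω → ℂ) × (E → ℂ))) : Prop where
  aemeasurable_fst : ∀ ⦃p⦄, p ∈ S → AEMeasurable p.1 P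
  memLp_snd : ∀ ⦃p⦄, p ∈ S → MemLp p.2 2 ρ
  integral_exp_re : ∀ ⦃p⦄, p ∈ S → ∫ ω, Complex.exp ((p.1 ω).re * Complex.I) ∂P =
    Complex.exp (-(∫ x, ‖p.2 x‖ ^ 2 ∂ρ : ℝ) / 4)

namespace IsIsonormal

variable {P : Measure Ω} {ρ : Measure E} {S : Submodule ℂ ((Ω → ℂ) × (E → ℂ))}
  {p q : (Ω → ℂ) × (E → ℂ)}

theorem charFun_map (hS : IsIsonormal P ρ S) (hp : p ∈ S) (t : ℂ) :
    charFun (P.map p.1) t = Complex.exp (-(‖t‖ ^ 2 * ∫ x, ‖p.2 x‖ ^ 2 ∂ρ : ℝ) / 4) := by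
  have h := hS.integral_exp_re (S.smul_mem (conj t) hp)
  simp only [Prod.smul_fst, Pi.smul_apply, smul_eq_mul, Prod.smul_snd, norm_mul,
    RCLike.norm_conj, mul_pow, integral_const_mul] at h
  rw [charFun_apply, integral_map (hS.aemeasurable_fst hp) (by fun_prop), ← h]
  simp_rw [real_inner_comm t, Complex.inner, mul_comm (conj t)]

theorem integral_exp_re_add (hS : IsIsonormal P ρ S) (hp : p ∈ S) (hq : q ∈ S)
    (horth : ∫ x, p.2 x * conj (q.2 x) ∂ρ = 0) :
    ∫ ω, Complex.exp ((p.1 ω + q.1 ω).re * Complex.I) ∂P =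
      (∫ ω, Complex.exp ((p.1 ω).re * Complex.I) ∂P) *
        ∫ ω, Complex.exp ((q.1 ω).re * Complex.I) ∂P := by
  have hadd : ∫ x, ‖(p + q).2 x‖ ^ 2 ∂ρ = _ :=
    integral_norm_add_sq (hS.memLp_snd hp) (hS.memLp_snd hq)
  rw [hS.integral_exp_re hp, hS.integral_exp_re hq, ← Complex.exp_add]
  refine (hS.integral_exp_re (S.add_mem hp hq)).trans (congrArg _ ?_)
  rw [hadd, horth]
  push_cast
  simp
  ring

variable [IsProbabilityMeasure P]

theorem map_eq (hS : IsIsonormal P ρ S) (hp : p ∈ S) :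
    P.map p.1 = stdComplexGaussian.map (fun z => √(∫ x, ‖p.2 x‖ ^ 2 ∂ρ) • z) := by
  have := Measure.isProbabilityMeasure_map (hS.aemeasurable_fst hp)
  refine Measure.ext_of_charFun (funext fun t => ?_)
  rw [hS.charFun_map hp, charFun_map_smul_stdComplexGaussian,
    Real.sq_sqrt (integral_nonneg fun x => by positivity)]

theorem map_eq_stdComplexGaussian (hS : IsIsonormal P ρ S) (hp : p ∈ S)
    (h1 : ∫ x, ‖p.2 x‖ ^ 2 ∂ρ = 1) : P.map p.1 = stdComplexGaussian := by
  simp [hS.map_eq hp, h1]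

theorem memLp_fst (hS : IsIsonormal P ρ S) (hp : p ∈ S) {q : ENNReal} (hq : q ≠ ⊤) :
    MemLp p.1 q P :=
  memLp_of_map_eq_smul (hS.aemeasurable_fst hp) (hS.map_eq hp) hq

theorem integral_norm_sq (hS : IsIsonormal P ρ S) (hp : p ∈ S) :
    ∫ ω, ‖p.1 ω‖ ^ 2 ∂P = ∫ x, ‖p.2 x‖ ^ 2 ∂ρ := by
  rw [integral_norm_sq_of_map_eq_smul (hS.aemeasurable_fst hp) (hS.map_eq hp),
    Real.sq_sqrt (integral_nonneg fun x => by positivity)]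

theorem re_integral_mul_conj (hS : IsIsonormal P ρ S) (hp : p ∈ S) (hq : q ∈ S) :
    (∫ ω, p.1 ω * conj (q.1 ω) ∂P).re = (∫ x, p.2 x * conj (q.2 x) ∂ρ).re := by
  have hadd : ∫ ω, ‖p.1 ω + q.1 ω‖ ^ 2 ∂P = ∫ x, ‖p.2 x + q.2 x‖ ^ 2 ∂ρ :=
    hS.integral_norm_sq (S.add_mem hp hq)
  rw [integral_norm_add_sq (hS.memLp_fst hp (by simp)) (hS.memLp_fst hq (by simp)),
    integral_norm_add_sq (hS.memLp_snd hp) (hS.memLp_snd hq),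
    hS.integral_norm_sq hp, hS.integral_norm_sq hq] at hadd
  linarith

theorem integral_mul_conj (hS : IsIsonormal P ρ S) (hp : p ∈ S) (hq : q ∈ S) :
    ∫ ω, p.1 ω * conj (q.1 ω) ∂P = ∫ x, p.2 x * conj (q.2 x) ∂ρ := by
  refine Complex.ext (hS.re_integral_mul_conj hp hq) ?_
  have h := hS.re_integral_mul_conj (S.smul_mem Complex.I hp) hq
  simp only [Prod.smul_fst, Prod.smul_snd, Pi.smul_apply, smul_eq_mul, mul_assoc,
    integral_const_mul, Complex.I_mul_re, neg_inj] at h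
  exact h

theorem indepFun {ι : Type*} [Finite ι] {q : ι → (Ω → ℂ) × (E → ℂ)} (hS : IsIsonormal P ρ S)
    (hp : p ∈ S) (hq : ∀ i, q i ∈ S) (horth : ∀ i, ∫ x, p.2 x * conj ((q i).2 x) ∂ρ = 0) :
    IndepFun p.1 (fun ω i => (q i).1 ω) P := by
  have := Fintype.ofFinite ι
  have mp := hS.aemeasurable_fst hp
  have mq : AEMeasurable (fun ω i => (q i).1 ω) P :=
    aemeasurable_pi_lambda _ fun i => hS.aemeasurable_fst (hq i)
  refine (indepFun_iff_charFunDual_prod mp mq).2 fun L => ?_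
  obtain ⟨a, ha⟩ := exists_eq_re_mul (L.comp (.inl ℝ _ _))
  obtain ⟨b, hb⟩ := exists_eq_re_sum_mul (L.comp (.inr ℝ _ _))
  have haS := S.smul_mem a hp
  have hbS : ∑ i, b i • q i ∈ S := S.sum_mem fun i _ => S.smul_mem _ (hq i)
  have hLadd : ∀ z w, L (z, w) = (a * z + ∑ i, b i * w i).re := fun z w => by
    rw [Complex.add_re, ← ha, ← hb, ← L.comp_inl_add_comp_inr]
  have horth' : ∫ x, (a • p).2 x * conj ((∑ i, b i • q i).2 x) ∂ρ = 0 := by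
    have hterm : ∀ i x, a * p.2 x * (conj (b i) * conj ((q i).2 x)) =
        a * conj (b i) * (p.2 x * conj ((q i).2 x)) := fun i x => mul_mul_mul_comm _ _ _ _
    simp only [Prod.snd_sum, Finset.sum_apply, Prod.smul_snd, Pi.smul_apply, smul_eq_mul,
      map_sum, map_mul, Finset.mul_sum, hterm]
    rw [integral_finsetSum _ fun i _ =>
      (integrable_mul_conj (hS.memLp_snd hp) (hS.memLp_snd (hq i))).const_mul _]
    simp only [integral_const_mul, horth, mul_zero, Finset.sum_const_zero]
  rw [charFunDual_apply, charFunDual_apply, charFunDual_apply,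
    integral_map (mp.prodMk mq) (by fun_prop), integral_map mp (by fun_prop),
    integral_map mq (by fun_prop)]
  simpa only [ha, hb, hLadd, Prod.fst_sum, Finset.sum_apply, Prod.smul_fst, Pi.smul_apply,
    smul_eq_mul] using hS.integral_exp_re_add haS hbS horth'

end IsIsonormal

end Isonormal

section DualFactor

/-- Functions with the phase of `z⁻¹`, normalized so that `N Z * Z` has mean one for a standard
complex Gaussian `Z`. The Wick-type identity below sees only these two features, so that it makes
the correlations of `z⁻¹` computable by comparison with the polynomial `conj z`. -/
structure IsDualFactor (N : ℂ → ℂ) : Prop where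
  measurable : Measurable N
  map_mul_of_norm_eq_one : ∀ c z : ℂ, ‖c‖ = 1 → N (c * z) = conj c * N z
  norm_le : ∀ z : ℂ, ‖N z‖ ≤ ‖z‖ ^ (-1 : ℝ) + ‖z‖ ^ (1 : ℝ)
  integral_mul_self : ∫ z, N z * z ∂stdComplexGaussian = 1

theorem isDualFactor_conj : IsDualFactor (fun z => conj z) where
  measurable := by fun_prop
  map_mul_of_norm_eq_one c z _ := map_mul _ c z
  norm_le z := by simpa using Real.rpow_nonneg (norm_nonneg z) (-1)
  integral_mul_self := by
    simp only [Complex.conj_mul']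
    exact_mod_cast congrArg ((↑) : ℝ → ℂ) integral_norm_sq_stdComplexGaussian

theorem isDualFactor_inv : IsDualFactor (fun z => z⁻¹) where
  measurable := by fun_prop
  map_mul_of_norm_eq_one c z hc := by
    simp [Complex.inv_def c, Complex.normSq_eq_norm_sq, hc, mul_comm]
  norm_le z := by
    rw [norm_inv, Real.rpow_neg_one, Real.rpow_one]
    linarith [norm_nonneg z]
  integral_mul_self := by
    rw [integral_congr_ae (ae_ne_zero_stdComplexGaussian.mono fun z hz => inv_mul_cancel₀ hz)]
    simp

namespace IsDualFactor

variable {N : ℂ → ℂ}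

theorem integrable_mul (hN : IsDualFactor N) {g : ℂ → ℂ} (hg : Measurable g)
    {q : ℝ} (hq : 0 ≤ q) (hgq : ∀ z, ‖g z‖ ≤ ‖z‖ ^ q) :
    Integrable (fun z => N z * g z) stdComplexGaussian := by
  have hsub := integrable_norm_rpow_stdComplexGaussian (q := -1 + q) (by linarith)
  have hsuper := integrable_norm_rpow_stdComplexGaussian (q := 1 + q) (by linarith)
  refine (hsub.add hsuper).mono' (hN.measurable.mul hg).aestronglyMeasurable ?_
  filter_upwards [ae_ne_zero_stdComplexGaussian] with z hz
  have hz' : 0 < ‖z‖ := norm_pos_iff.2 hz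
  rw [norm_mul, Pi.add_apply, Real.rpow_add hz', Real.rpow_add hz', ← add_mul]
  exact mul_le_mul (hN.norm_le z) (hgq z) (norm_nonneg _) (by positivity)

theorem integrable (hN : IsDualFactor N) : Integrable N stdComplexGaussian := by
  simpa using hN.integrable_mul (g := fun _ => 1) measurable_const le_rfl (fun z => by simp)

theorem integral_eq_zero (hN : IsDualFactor N) : ∫ z, N z ∂stdComplexGaussian = 0 :=
  integral_stdComplexGaussian_eq_zero_of_rotation (c := -1) (d := -1) (by simp) (by norm_num)
    fun z => by simpa using hN.map_mul_of_norm_eq_one (-1) z (by simp)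

theorem integral_mul_conj (hN : IsDualFactor N) :
    ∫ z, N z * conj z ∂stdComplexGaussian = 0 :=
  integral_stdComplexGaussian_eq_zero_of_rotation (c := Complex.I) (d := -1) (by simp)
    (by norm_num) fun z => by
      rw [hN.map_mul_of_norm_eq_one _ _ (by simp), map_mul, Complex.conj_I]
      linear_combination N z * conj z * Complex.I_sq

theorem integral_mul_mul_conj (hN : IsDualFactor N) :
    ∫ z, N z * (z * conj z) ∂stdComplexGaussian = 0 :=
  integral_stdComplexGaussian_eq_zero_of_rotation (c := -1) (d := -1) (by simp) (by norm_num)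
    fun z => by rw [hN.map_mul_of_norm_eq_one _ _ (by simp)]; simp

end IsDualFactor

end DualFactor

section WickFormula

variable {Ω : Type*} [MeasurableSpace Ω] {P : Measure Ω}

theorem memLp_two_mul_of_memLp_four {f g : Ω → ℂ} (hf : MemLp f 4 P) (hg : MemLp g 4 P) :
    MemLp (fun ω => f ω * g ω) 2 P :=
  haveI : ENNReal.HolderTriple 4 4 2 := ⟨by
    rw [show (4 : ENNReal) = 2 * 2 by norm_num, ENNReal.mul_inv (by simp) (by simp), ← mul_add,
      ENNReal.inv_two_add_inv_two, mul_one]⟩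
  hg.mul hf

theorem integral_comp_mul_of_indepFun {Z X : Ω → ℂ} (hZ : AEMeasurable Z P)
    (hlaw : P.map Z = stdComplexGaussian) (hZX : IndepFun Z X P) {φ : ℂ → ℂ}
    (hφ : Measurable φ) (hφi : Integrable φ stdComplexGaussian) (hX : Integrable X P) :
    Integrable (fun ω => φ (Z ω) * X ω) P ∧
      ∫ ω, φ (Z ω) * X ω ∂P = (∫ z, φ z ∂stdComplexGaussian) * ∫ ω, X ω ∂P := by
  have hind : IndepFun (fun ω => φ (Z ω)) X P := hZX.comp hφ measurable_id
  rw [← hlaw] at hφi ⊢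
  have hi : Integrable (fun ω => φ (Z ω)) P := hφi.comp_aemeasurable hZ
  exact ⟨hind.integrable_mul hi hX, by
    rw [integral_map hZ hφ.aestronglyMeasurable,
      hind.integral_fun_mul_eq_mul_integral hi.aestronglyMeasurable hX.aestronglyMeasurable]⟩

variable {N : ℂ → ℂ}

theorem IsDualFactor.integral_mul_of_indepFun [IsFiniteMeasure P] (hN : IsDualFactor N)
    {Z W U V : Ω → ℂ} (hZ : AEMeasurable Z P) (hlaw : P.map Z = stdComplexGaussian)
    (hind : IndepFun Z (fun ω => (W ω, U ω, V ω)) P)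
    (hW : MemLp W 2 P) (hU : MemLp U 4 P) (hV : MemLp V 4 P) (a c : ℂ) :
    Integrable (fun ω => N (Z ω) * W ω * ((c * Z ω + V ω) * conj (a * Z ω + U ω))) P ∧
      ∫ ω, N (Z ω) * W ω * ((c * Z ω + V ω) * conj (a * Z ω + U ω)) ∂P =
        c * ∫ ω, W ω * conj (U ω) ∂P := by
  have hU2 : MemLp U 2 P := hU.mono_exponent (by norm_num)
  have hV2 : MemLp V 2 P := hV.mono_exponent (by norm_num)
  have hzz := integral_comp_mul_of_indepFun hZ hlaw
    (φ := fun z => N z * (z * conj z)) (X := W)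
    (hind.comp measurable_id (by fun_prop : Measurable fun y : ℂ × ℂ × ℂ => y.1))
    (hN.measurable.mul (by fun_prop)) (hN.integrable_mul (g := fun z => z * conj z) (q := 2)
      (by fun_prop) (by norm_num) fun z => by simp [sq]) (hW.integrable (by norm_num))
  have hzu := integral_comp_mul_of_indepFun hZ hlaw
    (φ := fun z => N z * z) (X := fun ω => W ω * conj (U ω))
    (hind.comp measurable_id (by fun_prop : Measurable fun y : ℂ × ℂ × ℂ => y.1 * conj y.2.1))
    (hN.measurable.mul (by fun_prop)) (hN.integrable_mul (g := fun z => z) (q := 1)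
      (by fun_prop) (by norm_num) fun z => by simp) (integrable_mul_conj hW hU2)
  have hvz := integral_comp_mul_of_indepFun hZ hlaw
    (φ := fun z => N z * conj z) (X := fun ω => W ω * V ω)
    (hind.comp measurable_id (by fun_prop : Measurable fun y : ℂ × ℂ × ℂ => y.1 * y.2.2))
    (hN.measurable.mul (by fun_prop)) (hN.integrable_mul (g := fun z => conj z) (q := 1)
      (by fun_prop) (by norm_num) fun z => by simp) (hW.integrable_mul hV2)
  have hvu := integral_comp_mul_of_indepFun hZ hlaw (X := fun ω => W ω * (V ω * conj (U ω)))
    (hind.comp measurable_id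
      (by fun_prop : Measurable fun y : ℂ × ℂ × ℂ => y.1 * (y.2.2 * conj y.2.1)))
    hN.measurable hN.integrable (hW.integrable_mul (memLp_two_mul_of_memLp_four hV hU.star))
  have hexpand : ∀ ω, N (Z ω) * W ω * ((c * Z ω + V ω) * conj (a * Z ω + U ω)) =
      c * conj a * (N (Z ω) * (Z ω * conj (Z ω)) * W ω) +
        c * (N (Z ω) * Z ω * (W ω * conj (U ω))) +
        conj a * (N (Z ω) * conj (Z ω) * (W ω * V ω)) +
        N (Z ω) * (W ω * (V ω * conj (U ω))) := fun ω => by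
    rw [map_add, map_mul]
    ring
  have hi₂ := (hzz.1.const_mul (c * conj a)).fun_add (hzu.1.const_mul c)
  have hi₃ := hi₂.fun_add (hvz.1.const_mul (conj a))
  simp only [hexpand]
  refine ⟨hi₃.fun_add hvu.1, ?_⟩
  rw [integral_add hi₃ hvu.1, integral_add hi₂ (hvz.1.const_mul _),
    integral_add (hzz.1.const_mul _) (hzu.1.const_mul _)]
  simp only [integral_const_mul]
  rw [hzz.2, hzu.2, hvz.2, hvu.2, hN.integral_mul_mul_conj, hN.integral_mul_self,
    hN.integral_mul_conj, hN.integral_eq_zero]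
  ring

variable {E : Type*} [MeasurableSpace E] {ρ : Measure E}
  {S : Submodule ℂ ((Ω → ℂ) × (E → ℂ))} {z w u v : (Ω → ℂ) × (E → ℂ)}

theorem integral_mul_conj_sub_smul {f g h : E → ℂ} (hf : MemLp f 2 ρ) (hg : MemLp g 2 ρ)
    (hh : MemLp h 2 ρ) (c : ℂ) :
    ∫ x, f x * conj ((g - c • h) x) ∂ρ =
      ∫ x, f x * conj (g x) ∂ρ - conj c * ∫ x, f x * conj (h x) ∂ρ := by
  have hterm : ∀ x, f x * conj ((g - c • h) x) =
      f x * conj (g x) - conj c * (f x * conj (h x)) := fun x => by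
    simp only [Pi.sub_apply, Pi.smul_apply, smul_eq_mul, map_sub, map_mul]
    ring
  simp only [hterm]
  rw [integral_sub (integrable_mul_conj hf hg) ((integrable_mul_conj hf hh).const_mul _),
    integral_const_mul]

theorem integral_mul_conj_sub_proj_eq_zero {f g : E → ℂ} (hf : MemLp f 2 ρ) (hg : MemLp g 2 ρ)
    (hf1 : ∫ x, ‖f x‖ ^ 2 ∂ρ = 1) :
    ∫ x, f x * conj ((g - (∫ y, g y * conj (f y) ∂ρ) • f) x) ∂ρ = 0 := by
  have hff : ∫ x, f x * conj (f x) ∂ρ = 1 := by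
    simp only [Complex.mul_conj']
    exact_mod_cast congrArg ((↑) : ℝ → ℂ) hf1
  rw [integral_mul_conj_sub_smul hf hg hf, hff, ← integral_conj]
  simp [mul_comm]

namespace IsIsonormal

variable [IsProbabilityMeasure P]

-- Project `u` and `v` onto `z`: the remainders, like `w`, are independent of `z`.
theorem integral_dualFactor_mul (hS : IsIsonormal P ρ S) (hN : IsDualFactor N)
    (hz : z ∈ S) (hw : w ∈ S) (hu : u ∈ S) (hv : v ∈ S)
    (hz1 : ∫ x, ‖z.2 x‖ ^ 2 ∂ρ = 1) (hzw : ∫ x, z.2 x * conj (w.2 x) ∂ρ = 0) :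
    Integrable (fun ω => N (z.1 ω) * w.1 ω * (v.1 ω * conj (u.1 ω))) P ∧
    ∫ ω, N (z.1 ω) * w.1 ω * (v.1 ω * conj (u.1 ω)) ∂P =
      (∫ x, v.2 x * conj (z.2 x) ∂ρ) * ∫ x, w.2 x * conj (u.2 x) ∂ρ := by
  set a := ∫ x, u.2 x * conj (z.2 x) ∂ρ
  set c := ∫ x, v.2 x * conj (z.2 x) ∂ρ
  have hu' : u - a • z ∈ S := S.sub_mem hu (S.smul_mem a hz)
  have hv' : v - c • z ∈ S := S.sub_mem hv (S.smul_mem c hz)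
  have hq : ∀ i, ![w, u - a • z, v - c • z] i ∈ S := by simp [Fin.forall_fin_succ, hw, hu', hv']
  have hind := hS.indepFun hz hq fun i => by
    fin_cases i
    · exact hzw
    · exact integral_mul_conj_sub_proj_eq_zero (hS.memLp_snd hz) (hS.memLp_snd hu) hz1
    · exact integral_mul_conj_sub_proj_eq_zero (hS.memLp_snd hz) (hS.memLp_snd hv) hz1
  have hwick := hN.integral_mul_of_indepFun (hS.aemeasurable_fst hz)
    (hS.map_eq_stdComplexGaussian hz hz1)
    (hind.comp measurable_id (by fun_prop : Measurable fun y : Fin 3 → ℂ => (y 0, y 1, y 2)))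
    (hS.memLp_fst hw (by simp)) (hS.memLp_fst hu' (by simp)) (hS.memLp_fst hv' (by simp)) a c
  have hwz : ∫ x, w.2 x * conj (z.2 x) ∂ρ = 0 := by
    simpa [← integral_conj, mul_comm] using congrArg conj hzw
  have hwu : ∫ ω, w.1 ω * conj ((u - a • z).1 ω) ∂P = ∫ x, w.2 x * conj (u.2 x) ∂ρ := by
    rw [hS.integral_mul_conj hw hu', Prod.snd_sub, Prod.smul_snd, integral_mul_conj_sub_smul
      (hS.memLp_snd hw) (hS.memLp_snd hu) (hS.memLp_snd hz), hwz, mul_zero, sub_zero]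
  rw [← hwu]
  simpa using hwick

theorem integral_im_dualFactor_mul_im (hS : IsIsonormal P ρ S) (hN : IsDualFactor N)
    (hz : z ∈ S) (hw : w ∈ S) (hu : u ∈ S) (hv : v ∈ S)
    (hz1 : ∫ x, ‖z.2 x‖ ^ 2 ∂ρ = 1) (hzw : ∫ x, z.2 x * conj (w.2 x) ∂ρ = 0) :
    Integrable (fun ω => (N (z.1 ω) * w.1 ω).im * (v.1 ω * conj (u.1 ω)).im) P ∧
    ∫ ω, (N (z.1 ω) * w.1 ω).im * (v.1 ω * conj (u.1 ω)).im ∂P =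
      ((∫ x, u.2 x * conj (z.2 x) ∂ρ) * (∫ x, w.2 x * conj (v.2 x) ∂ρ) -
        (∫ x, v.2 x * conj (z.2 x) ∂ρ) * ∫ x, w.2 x * conj (u.2 x) ∂ρ).re / 2 := by
  have hvu := hS.integral_dualFactor_mul hN hz hw hu hv hz1 hzw
  have huv := hS.integral_dualFactor_mul hN hz hw hv hu hz1 hzw
  have him : ∀ ω, (N (z.1 ω) * w.1 ω).im * (v.1 ω * conj (u.1 ω)).im =
      (N (z.1 ω) * w.1 ω * (u.1 ω * conj (v.1 ω)) -
        N (z.1 ω) * w.1 ω * (v.1 ω * conj (u.1 ω))).re / 2 := fun ω => by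
    rw [show u.1 ω * conj (v.1 ω) = conj (v.1 ω * conj (u.1 ω)) by simp [mul_comm]]
    simp only [Complex.sub_re, Complex.mul_re (N _ * _), Complex.conj_re, Complex.conj_im]
    ring
  simp only [him]
  refine ⟨(huv.1.sub hvu.1).re.div_const 2, ?_⟩
  rw [integral_div, ← hvu.2, ← huv.2, ← integral_sub huv.1 hvu.1]
  exact congrArg (· / 2) (integral_re (huv.1.sub hvu.1))

end IsIsonormal

end WickFormula

section GaussianVector

theorem map_sum_mul_pi_stdComplexGaussian {ι : Type*} [Fintype ι] (b : ι → ℂ) :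
    (Measure.pi fun _ : ι => stdComplexGaussian).map (fun v => ∑ i, b i * v i) =
      stdComplexGaussian.map (fun z => √(∑ i, ‖b i‖ ^ 2) • z) := by
  have hmeas : Measurable fun v : ι → ℂ => ∑ i, b i * v i := by fun_prop
  have := Measure.isProbabilityMeasure_map
    (μ := Measure.pi fun _ : ι => stdComplexGaussian) hmeas.aemeasurable
  refine Measure.ext_of_charFun (funext fun t => ?_)
  have hexp : ∀ v : ι → ℂ, Complex.exp (inner ℝ (∑ i, b i * v i) t * Complex.I) =
      ∏ i, Complex.exp (inner ℝ (v i) (conj (b i) * t) * Complex.I) := fun v => by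
    rw [sum_inner, ← Complex.exp_sum, ← Finset.sum_mul, Complex.ofReal_sum]
    simp only [Complex.inner, map_mul, mul_assoc, mul_left_comm]
  rw [charFun_apply, integral_map hmeas.aemeasurable (by fun_prop)]
  simp only [hexp]
  rw [integral_fintype_prod_eq_prod
    (f := fun i z => Complex.exp (inner ℝ z (conj (b i) * t) * Complex.I))]
  simp only [← charFun_apply, charFun_stdComplexGaussian]
  rw [charFun_map_smul_stdComplexGaussian, Real.sq_sqrt (by positivity), ← Complex.exp_sum]
  simp only [norm_mul, RCLike.norm_conj, mul_pow, neg_div, Finset.mul_sum, Complex.ofReal_sum,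
    Finset.sum_div, Finset.sum_neg_distrib, mul_comm]

variable {Ω : Type*} [MeasurableSpace Ω] {P : Measure Ω}

theorem IsComplexGaussianVector.exists_map_sum_mul_eq {n : ℕ} {X : Ω → Fin n → ℂ}
    (hX : IsComplexGaussianVector X P) (c : Fin n → ℂ) :
    ∃ σ : ℝ, P.map (fun ω => ∑ j, c j * X ω j) = stdComplexGaussian.map (fun z => σ • z) := by
  obtain ⟨hm, m, A, hA⟩ := hX
  have hc : Measurable fun x : Fin n → ℂ => ∑ j, c j * x j := by fun_prop
  have hAm : Measurable fun v : Fin m → ℂ => A *ᵥ v :=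
    (continuous_const.matrix_mulVec continuous_id).measurable
  refine ⟨√(∑ i, ‖(c ᵥ* A) i‖ ^ 2), ?_⟩
  rw [← Function.comp_def (fun x : Fin n → ℂ => ∑ j, c j * x j) X,
    ← AEMeasurable.map_map_of_aemeasurable hc.aemeasurable hm, hA, Measure.map_map hc hAm,
    ← map_sum_mul_pi_stdComplexGaussian]
  exact congrArg (Measure.map · _) (funext fun v => Matrix.dotProduct_mulVec c A v)

end GaussianVector

section StationaryProcess

theorem integral_norm_sum_sq {α ι : Type*} [MeasurableSpace α] {μ : Measure α} [Fintype ι]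
    (c : ι → ℂ) (x : ι → α → ℂ) (hx : ∀ i, MemLp (x i) 2 μ) :
    ((∫ a, ‖∑ i, c i * x i a‖ ^ 2 ∂μ : ℝ) : ℂ) =
      ∑ i, ∑ j, c i * conj (c j) * ∫ a, x i a * conj (x j a) ∂μ := by
  have hexpand : ∀ a, ((‖∑ i, c i * x i a‖ ^ 2 : ℝ) : ℂ) =
      ∑ i, ∑ j, c i * conj (c j) * (x i a * conj (x j a)) := fun a => by
    rw [Complex.ofReal_pow, ← Complex.mul_conj', map_sum, Finset.sum_mul_sum]
    simp only [map_mul, mul_mul_mul_comm]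
  have hi : ∀ i j, Integrable (fun a => c i * conj (c j) * (x i a * conj (x j a))) μ :=
    fun i j => (integrable_mul_conj (hx i) (hx j)).const_mul _
  rw [← integral_complex_ofReal]
  simp only [hexpand]
  rw [integral_finsetSum _ fun i _ => integrable_finsetSum _ fun j _ => hi i j]
  refine Finset.sum_congr rfl fun i _ => ?_
  rw [integral_finsetSum _ fun j _ => hi i j]
  simp only [integral_const_mul]

/-- The image of `f t` under the spectral isometry from the span of the process to `L²(ρ)`. -/
noncomputable def spectralExp (t l : ℝ) : ℂ := Complex.exp (-Complex.I * t * l)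

theorem norm_spectralExp (t l : ℝ) : ‖spectralExp t l‖ = 1 := by
  rw [spectralExp, Complex.norm_exp]
  simp

theorem continuous_spectralExp (t : ℝ) : Continuous (spectralExp t) := by
  unfold spectralExp
  fun_prop

theorem conj_spectralExp (t l : ℝ) : conj (spectralExp t l) = spectralExp (-t) l := by
  rw [spectralExp, spectralExp, ← Complex.exp_conj]
  simp

theorem spectralExp_add (s t l : ℝ) :
    spectralExp (s + t) l = spectralExp s l * spectralExp t l := by
  rw [spectralExp, spectralExp, spectralExp, ← Complex.exp_add]
  congr 1
  push_cast
  ring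

theorem memLp_spectralExp {ρ : Measure ℝ} [IsFiniteMeasure ρ] (t : ℝ) :
    MemLp (spectralExp t) 2 ρ :=
  MemLp.of_bound (continuous_spectralExp t).aestronglyMeasurable 1
    (.of_forall fun l => (norm_spectralExp t l).le)

variable {Ω : Type*} {f : ℝ → Ω → ℂ}

/-- The linear span of a process, each variable paired with its spectral representative. -/
def processSpan (f : ℝ → Ω → ℂ) : Submodule ℂ ((Ω → ℂ) × (ℝ → ℂ)) :=
  Submodule.span ℂ (Set.range fun t => (f t, spectralExp t))

theorem mem_processSpan (f : ℝ → Ω → ℂ) (t : ℝ) : (f t, spectralExp t) ∈ processSpan f :=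
  Submodule.subset_span ⟨t, rfl⟩

theorem exists_eq_sum_of_mem_processSpan {p : (Ω → ℂ) × (ℝ → ℂ)} (hp : p ∈ processSpan f) :
    ∃ (n : ℕ) (c : Fin n → ℂ) (t : Fin n → ℝ),
      p = (fun ω => ∑ i, c i * f (t i) ω, fun l => ∑ i, c i * spectralExp (t i) l) := by
  obtain ⟨n, c, g, rfl⟩ := Submodule.mem_span_set'.1 hp
  choose t ht using fun i => (g i).2
  refine ⟨n, c, t, Prod.ext (funext fun ω => ?_) (funext fun l => ?_)⟩ <;>
    simp [← ht, Prod.fst_sum, Prod.snd_sum]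

variable [MeasurableSpace Ω] {P : Measure Ω}

namespace IsGSP

theorem aemeasurable (hf : IsGSP f P) (t : ℝ) : AEMeasurable (f t) P :=
  (measurable_pi_apply 0).comp_aemeasurable (hf.gaussian 1 fun _ => t).1

theorem memLp (hf : IsGSP f P) (t : ℝ) : MemLp (f t) 2 P := by
  obtain ⟨σ, h⟩ := (hf.gaussian 1 fun _ => t).exists_map_sum_mul_eq fun _ => 1
  exact memLp_of_map_eq_smul (hf.aemeasurable t) (by simpa using h) (by simp)

theorem integral_mul_conj (hf : IsGSP f P) (s t : ℝ) :
    ∫ ω, f s ω * conj (f t ω) ∂P = covarianceKernel f P (s - t) := by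
  have hmap : ∀ u : Fin 2 → ℝ, ∫ ω, f (u 0) ω * conj (f (u 1) ω) ∂P =
      ∫ x : Fin 2 → ℂ, x 0 * conj (x 1) ∂(P.map fun ω i => f (u i) ω) := fun u => by
    rw [integral_map (aemeasurable_pi_lambda _ fun i => hf.aemeasurable (u i)) (by fun_prop)]
  have hshift := hmap fun i => ![s - t, 0] i + t
  rw [hf.stationary, ← hmap] at hshift
  simpa [covarianceKernel] using hshift

theorem isIsonormal_processSpan (hf : IsGSP f P) {r : ℝ → ℂ} {ρ : Measure ℝ}
    (hρ : IsSpectralMeasure r ρ) (hr : ∀ t, covarianceKernel f P t = r t) :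
    IsIsonormal P ρ (processSpan f) := by
  have := hρ.1
  have hcov : ∀ s t, ∫ ω, f s ω * conj (f t ω) ∂P =
      ∫ l, spectralExp s l * conj (spectralExp t l) ∂ρ := fun s t => by
    simp only [conj_spectralExp, ← spectralExp_add, ← sub_eq_add_neg]
    exact (hf.integral_mul_conj s t).trans ((hr _).trans (hρ.2 _))
  have hmeas : ∀ {n} (c : Fin n → ℂ) (t : Fin n → ℝ),
      AEMeasurable (fun ω => ∑ i, c i * f (t i) ω) P := fun c t =>
    Finset.aemeasurable_fun_sum _ fun i _ => (hf.aemeasurable (t i)).const_mul _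
  refine ⟨fun p hp => ?_, fun p hp => ?_, fun p hp => ?_⟩ <;>
    obtain ⟨n, c, t, rfl⟩ := exists_eq_sum_of_mem_processSpan hp
  · exact hmeas c t
  · exact memLp_finsetSum Finset.univ fun i _ => (memLp_spectralExp (t i)).const_mul (c i)
  · obtain ⟨σ, h⟩ := (hf.gaussian n t).exists_map_sum_mul_eq c
    rw [integral_exp_re_of_map_eq_smul (hmeas c t) h,
      integral_norm_sum_sq c _ fun i => hf.memLp (t i),
      integral_norm_sum_sq c _ fun i => memLp_spectralExp (ρ := ρ) (t i)]
    simp only [hcov]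

end IsGSP

end StationaryProcess

section LimitLTwo

variable {E : Type*} [MeasurableSpace E] {μ : Measure E}

theorem toReal_eLpNorm_two_sq {g : E → ℂ} (hg : MemLp g 2 μ) :
    (eLpNorm g 2 μ).toReal ^ 2 = ∫ x, ‖g x‖ ^ 2 ∂μ := by
  rw [hg.eLpNorm_eq_integral_rpow_norm (by simp) (by simp), ENNReal.toReal_ofReal (by positivity),
    ← Real.rpow_natCast, ← Real.rpow_mul (by positivity)]
  simp

variable {u : ℕ → E → ℂ} {h : E → ℂ}

theorem tendsto_eLpNorm_two_sub (hu : ∀ n, MemLp (u n) 2 μ)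
    (hcauchy : Tendsto (fun k : ℕ × ℕ => ∫ x, ‖(u k.1 - u k.2) x‖ ^ 2 ∂μ) atTop (𝓝 0))
    (hlim : ∀ x, Tendsto (fun n => u n x) atTop (𝓝 (h x))) :
    Tendsto (fun n => eLpNorm (u n - h) 2 μ) atTop (𝓝 0) := by
  have hpair : Tendsto (fun k : ℕ × ℕ => eLpNorm (u k.1 - u k.2) 2 μ) atTop (𝓝 0) := by
    have hsub := fun k : ℕ × ℕ => (hu k.1).sub (hu k.2)
    refine (ENNReal.tendsto_toReal_iff (fun k => (hsub k).eLpNorm_ne_top) ENNReal.zero_ne_top).1 ?_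
    have hsqrt := (Real.continuous_sqrt.tendsto 0).comp hcauchy
    rw [Real.sqrt_zero] at hsqrt
    refine hsqrt.congr fun k => ?_
    rw [Function.comp_apply, ← toReal_eLpNorm_two_sq (hsub k),
      Real.sqrt_sq ENNReal.toReal_nonneg]
  refine ENNReal.tendsto_nhds_zero.2 fun ε hε => ?_
  have hev := ENNReal.tendsto_nhds_zero.1 hpair ε hε
  rw [← prod_atTop_atTop_eq] at hev
  filter_upwards [hev.curry] with n hn
  exact Lp.eLpNorm_le_of_ae_tendsto hn
    (fun m => ((hu n).sub (hu m)).aestronglyMeasurable)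
    (.of_forall fun x => (hlim x).const_sub (u n x))

theorem memLp_two_of_tendsto_eLpNorm (hu : ∀ n, MemLp (u n) 2 μ)
    (hL : Tendsto (fun n => eLpNorm (u n - h) 2 μ) atTop (𝓝 0))
    (hlim : ∀ x, Tendsto (fun n => u n x) atTop (𝓝 (h x))) : MemLp h 2 μ := by
  have hh : AEStronglyMeasurable h μ := aestronglyMeasurable_of_tendsto_ae atTop
    (fun n => (hu n).aestronglyMeasurable) (.of_forall hlim)
  obtain ⟨n, hn⟩ := (hL.eventually_lt_const zero_lt_one).exists
  have hsub : MemLp (u n - h) 2 μ :=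
    ⟨(hu n).aestronglyMeasurable.sub hh, hn.trans ENNReal.one_lt_top⟩
  simpa using (hu n).sub hsub

theorem tendsto_integral_norm_sq (hu : ∀ n, MemLp (u n) 2 μ) (hh : MemLp h 2 μ)
    (hL : Tendsto (fun n => eLpNorm (u n - h) 2 μ) atTop (𝓝 0)) :
    Tendsto (fun n => ∫ x, ‖u n x‖ ^ 2 ∂μ) atTop (𝓝 (∫ x, ‖h x‖ ^ 2 ∂μ)) := by
  have hnorm := ((Lp.tendsto_Lp_iff_tendsto_eLpNorm'' u hu h hh).2 hL).norm.pow 2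
  simpa only [Lp.norm_toLp, toReal_eLpNorm_two_sq, hu, hh] using hnorm

end LimitLTwo

section Closure

variable {Ω E ι : Type*} [MeasurableSpace Ω]

/-- Simultaneous limits of sequences in `S`, almost sure in the first component and pointwise in
the second one. No domination is imposed: for Gaussian families almost sure convergence already
forces convergence in `L²`. -/
def aeSeqClosure (P : Measure Ω) (S : Submodule ℂ ((Ω → ℂ) × (E → ℂ))) :
    Submodule ℂ ((Ω → ℂ) × (E → ℂ)) where
  carrier := {p | ∃ u : ℕ → (Ω → ℂ) × (E → ℂ), (∀ n, u n ∈ S) ∧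
    (∀ᵐ ω ∂P, Tendsto (fun n => (u n).1 ω) atTop (𝓝 (p.1 ω))) ∧
    ∀ x, Tendsto (fun n => (u n).2 x) atTop (𝓝 (p.2 x))}
  add_mem' := by
    rintro p q ⟨u, hu, hu1, hu2⟩ ⟨v, hv, hv1, hv2⟩
    exact ⟨fun n => u n + v n, fun n => S.add_mem (hu n) (hv n),
      hu1.mp (hv1.mono fun ω h1 h2 => h2.add h1), fun x => (hu2 x).add (hv2 x)⟩
  zero_mem' := ⟨fun _ => 0, fun _ => S.zero_mem, by simp, by simp⟩
  smul_mem' := by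
    rintro c p ⟨u, hu, hu1, hu2⟩
    exact ⟨fun n => c • u n, fun n => S.smul_mem c (hu n),
      hu1.mono fun ω h => h.const_mul c, fun x => (hu2 x).const_mul c⟩

variable {P : Measure Ω} {S : Submodule ℂ ((Ω → ℂ) × (E → ℂ))}

theorem le_aeSeqClosure : S ≤ aeSeqClosure P S := fun p hp =>
  ⟨fun _ => p, fun _ => hp, by simp, by simp⟩

theorem tendsto_integral_exp_re [IsFiniteMeasure P] {l : Filter ι} [l.IsCountablyGenerated]
    {X : ι → Ω → ℂ} {Y : Ω → ℂ} (hX : ∀ i, AEMeasurable (X i) P)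
    (hXY : ∀ᵐ ω ∂P, Tendsto (fun i => X i ω) l (𝓝 (Y ω))) :
    Tendsto (fun i => ∫ ω, Complex.exp ((X i ω).re * Complex.I) ∂P) l
      (𝓝 (∫ ω, Complex.exp ((Y ω).re * Complex.I) ∂P)) := by
  have hcont : Continuous fun z : ℂ => Complex.exp (z.re * Complex.I) := by fun_prop
  refine tendsto_integral_filter_of_dominated_convergence (fun _ => 1)
    (.of_forall fun i => (hcont.measurable.comp_aemeasurable (hX i)).aestronglyMeasurable)
    (.of_forall fun i => .of_forall fun ω => (Complex.norm_exp_ofReal_mul_I _).le)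
    (integrable_const _) ?_
  filter_upwards [hXY] with ω hω using (hcont.tendsto _).comp hω

namespace IsIsonormal

variable [MeasurableSpace E] {ρ : Measure E} [IsProbabilityMeasure P]

theorem tendsto_integral_norm_sq_of_ae_tendsto_zero (hS : IsIsonormal P ρ S) {l : Filter ι}
    [l.IsCountablyGenerated] {v : ι → (Ω → ℂ) × (E → ℂ)} (hv : ∀ i, v i ∈ S)
    (hv0 : ∀ᵐ ω ∂P, Tendsto (fun i => (v i).1 ω) l (𝓝 0)) :
    Tendsto (fun i => ∫ x, ‖(v i).2 x‖ ^ 2 ∂ρ) l (𝓝 0) := by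
  have hexp := (tendsto_integral_exp_re (fun i => hS.aemeasurable_fst (hv i)) hv0).norm.log
    (by simp)
  simp only [hS.integral_exp_re (hv _), Complex.norm_exp, Real.log_exp] at hexp
  simpa [neg_div, mul_div_cancel₀] using hexp.const_mul (-4)

theorem aeSeqClosure (hS : IsIsonormal P ρ S) : IsIsonormal P ρ (aeSeqClosure P S) := by
  have hlimit : ∀ p ∈ _root_.aeSeqClosure P S, AEMeasurable p.1 P ∧ MemLp p.2 2 ρ ∧
      ∫ ω, Complex.exp ((p.1 ω).re * Complex.I) ∂P =
        Complex.exp (-(∫ x, ‖p.2 x‖ ^ 2 ∂ρ : ℝ) / 4) := by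
    rintro p ⟨u, hu, hu1, hu2⟩
    have hu1m := fun n => hS.aemeasurable_fst (hu n)
    have hu2L := fun n => hS.memLp_snd (hu n)
    have hcauchy := hS.tendsto_integral_norm_sq_of_ae_tendsto_zero (l := atTop)
      (v := fun k : ℕ × ℕ => u k.1 - u k.2) (fun k => S.sub_mem (hu k.1) (hu k.2)) (by
        filter_upwards [hu1] with ω hω
        rw [← prod_atTop_atTop_eq, ← sub_self (p.1 ω)]
        exact (hω.comp tendsto_fst).sub (hω.comp tendsto_snd))
    have hL := tendsto_eLpNorm_two_sub hu2L hcauchy hu2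
    have hp2 := memLp_two_of_tendsto_eLpNorm hu2L hL hu2
    refine ⟨aemeasurable_of_tendsto_metrizable_ae atTop hu1m hu1, hp2,
      tendsto_nhds_unique (tendsto_integral_exp_re hu1m hu1) ?_⟩
    simp only [hS.integral_exp_re (hu _)]
    have hcont : Continuous fun a : ℝ => Complex.exp (-(a : ℂ) / 4) := by fun_prop
    exact (hcont.tendsto _).comp (tendsto_integral_norm_sq hu2L hp2 hL)
  exact ⟨fun p hp => (hlimit p hp).1, fun p hp => (hlimit p hp).2.1,
    fun p hp => (hlimit p hp).2.2⟩

end IsIsonormal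

end Closure

section Derivative

theorem tendsto_add_one_div_nhdsNE (t : ℝ) :
    Tendsto (fun n : ℕ => t + 1 / ((n : ℝ) + 1)) atTop (𝓝[≠] t) := by
  refine tendsto_nhdsWithin_iff.2 ⟨?_, .of_forall fun n => ?_⟩
  · simpa using (tendsto_one_div_add_atTop_nhds_zero_nat (𝕜 := ℝ)).const_add t
  · simpa using (Nat.one_div_pos_of_nat (α := ℝ) (n := n)).ne'

theorem hasDerivAt_spectralExp (t l : ℝ) :
    HasDerivAt (fun s => spectralExp s l) (-Complex.I * l * spectralExp t l) t := by
  have hlin : HasDerivAt (fun s : ℝ => -Complex.I * s * l) (-Complex.I * l) t := by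
    simpa using (Complex.ofRealCLM.hasDerivAt.const_mul (-Complex.I)).mul_const (l : ℂ)
  simpa only [spectralExp, mul_comm (-Complex.I * (l : ℂ))] using hlin.cexp

variable {Ω : Type*} [MeasurableSpace Ω] {P : Measure Ω} {f : ℝ → Ω → ℂ}

theorem deriv_mem_aeSeqClosure {t : ℝ}
    (hd : ∀ᵐ ω ∂P, DifferentiableAt ℝ (fun s => f s ω) t) :
    (fun ω => deriv (fun s => f s ω) t, fun l => -Complex.I * l * spectralExp t l) ∈
      aeSeqClosure P (processSpan f) := by
  refine ⟨fun n => (((t + 1 / ((n : ℝ) + 1) - t)⁻¹ : ℝ) : ℂ) •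
      ((f (t + 1 / ((n : ℝ) + 1)), spectralExp (t + 1 / ((n : ℝ) + 1))) - (f t, spectralExp t)),
    fun n => Submodule.smul_mem _ _
      (sub_mem (mem_processSpan f _) (mem_processSpan f t)), ?_, fun l => ?_⟩
  · filter_upwards [hd] with ω hω
    exact hω.hasDerivAt.tendsto_slope.comp (tendsto_add_one_div_nhdsNE t)
  · exact (hasDerivAt_spectralExp t l).tendsto_slope.comp (tendsto_add_one_div_nhdsNE t)

theorem IsIsonormal.memLp_id_of_ae_differentiableAt [IsProbabilityMeasure P] {ρ : Measure ℝ}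
    (hS : IsIsonormal P ρ (processSpan f)) {t : ℝ}
    (hd : ∀ᵐ ω ∂P, DifferentiableAt ℝ (fun s => f s ω) t) : MemLp (fun l : ℝ => l) 2 ρ := by
  refine (hS.aeSeqClosure.memLp_snd (deriv_mem_aeSeqClosure hd)).congr_norm
    measurable_id.aestronglyMeasurable (.of_forall fun l => ?_)
  simp [norm_spectralExp]

end Derivative

section Modification

variable {Ω : Type*} [MeasurableSpace Ω] {P : Measure Ω} {f : ℝ → Ω → ℂ}

theorem exists_measurable_contDiff_modification (hm : ∀ t, AEMeasurable (f t) P)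
    (hd : ∀ᵐ ω ∂P, ContDiff ℝ 1 (fun t => f t ω)) :
    ∃ g : ℝ → Ω → ℂ, (∀ t, Measurable (g t)) ∧ (∀ ω, ContDiff ℝ 1 (fun t => g t ω)) ∧
      ∀ᵐ ω ∂P, ∀ t, f t ω = g t ω := by
  have hgood : ∀ᵐ ω ∂P, ContDiff ℝ 1 (fun t => f t ω) ∧ ∀ q : ℚ, f q ω = (hm q).mk _ ω :=
    hd.and (ae_all_iff.2 fun q => (hm q).ae_eq_mk)
  obtain ⟨s, hs, hsm, hsP⟩ := exists_measurable_superset_of_null (ae_iff.1 hgood)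
  have hs' : ∀ ω ∉ s, ContDiff ℝ 1 (fun t => f t ω) ∧ ∀ q : ℚ, f q ω = (hm q).mk _ ω :=
    fun ω hω => of_not_not fun h => hω (hs h)
  have hC : ∀ ω, ContDiff ℝ 1 (fun t => sᶜ.indicator (f t) ω) := fun ω => by
    by_cases h : ω ∈ s
    · simp [h, contDiff_const]
    · simpa [h] using (hs' ω h).1
  have hQ : ∀ q : ℚ, Measurable (sᶜ.indicator (f q)) := fun q => by
    rw [show sᶜ.indicator (f q) = sᶜ.indicator ((hm q).mk _) from
      Set.indicator_congr fun ω hω => (hs' ω hω).2 q]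
    exact (hm q).measurable_mk.indicator hsm.compl
  refine ⟨fun t => sᶜ.indicator (f t), fun t => ?_, hC, ?_⟩
  · obtain ⟨u, hu, hut⟩ := mem_closure_iff_seq_limit.1 (Rat.denseRange_cast (𝕜 := ℝ) t)
    refine measurable_of_tendsto_metrizable (f := fun n => sᶜ.indicator (f (u n)))
      (fun n => ?_) (tendsto_pi_nhds.2 fun ω => ((hC ω).continuous.tendsto t).comp hut)
    obtain ⟨q, hq⟩ := hu n
    exact hq ▸ hQ q
  · filter_upwards [measure_eq_zero_iff_ae_notMem.1 hsP] with ω hω t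
    simp [hω]

theorem measurable_uncurry_deriv (hm : ∀ t, Measurable (f t))
    (hd : ∀ ω, ContDiff ℝ 1 (fun t => f t ω)) :
    Measurable (Function.uncurry fun t ω => deriv (fun s => f s ω) t) := by
  refine measurable_uncurry_of_continuous_of_measurable
    (fun ω => (hd ω).continuous_deriv le_rfl) fun t => ?_
  refine measurable_of_tendsto_metrizable
    (f := fun (n : ℕ) ω => slope (fun s => f s ω) t (t + 1 / ((n : ℝ) + 1))) (fun n => ?_)
    (tendsto_pi_nhds.2 fun ω => ((hd ω).differentiable one_ne_zero t).hasDerivAt.tendsto_slope.comp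
      (tendsto_add_one_div_nhdsNE t))
  simp only [slope_def_module]
  exact ((hm _).sub (hm _)).const_smul _

theorem IsGSP.congr {g : ℝ → Ω → ℂ} (hf : IsGSP f P) (h : ∀ᵐ ω ∂P, ∀ t, f t ω = g t ω) :
    IsGSP g P := by
  have hfg : ∀ {n : ℕ} (t : Fin n → ℝ),
      (fun ω i => f (t i) ω) =ᵐ[P] fun ω i => g (t i) ω := fun t =>
    h.mono fun ω hω => funext fun i => hω _
  refine ⟨fun n t => ?_, fun n t s => ?_⟩
  · obtain ⟨hm, m, A, hA⟩ := hf.gaussian n t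
    exact ⟨hm.congr (hfg t), m, A, by rw [← Measure.map_congr (hfg t), hA]⟩
  · rw [← Measure.map_congr (hfg t), ← Measure.map_congr (hfg fun i => t i + s)]
    exact hf.stationary n t s

end Modification

section NonDegenerate

theorem mul_measureReal_le_integral {α : Type*} [MeasurableSpace α] {μ : Measure α}
    [IsFiniteMeasure μ] {f : α → ℝ} (hf : Integrable f μ) (hf0 : ∀ x, 0 ≤ f x) {s : Set α}
    (hs : MeasurableSet s) {c : ℝ} (hc : ∀ x ∈ s, c ≤ f x) : c * μ.real s ≤ ∫ x, f x ∂μ :=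
  (setIntegral_ge_of_const_le_real hs (measure_ne_top _ _) hc hf.integrableOn).trans
    (setIntegral_le_integral hf (.of_forall hf0))

variable {ρ : Measure ℝ} [IsProbabilityMeasure ρ]

theorem exists_mem_support_ne (hρ : ¬ IsDegenerate ρ) (φ : ℝ) : ∃ c ∈ ρ.support, c ≠ φ := by
  by_contra! h
  have hφ : (fun x : ℝ => x) =ᵐ[ρ] fun _ => φ :=
    Filter.mem_of_superset ρ.support_mem_ae h
  have hmap : ρ.map (fun x => x) = ρ.map (fun _ => φ) := Measure.map_congr hφ
  refine hρ ⟨φ, ?_⟩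
  simpa using hmap

theorem measureReal_closedBall_pos_of_mem_support {c r : ℝ} (hc : c ∈ ρ.support) (hr : 0 < r) :
    0 < ρ.real (Metric.closedBall c r) :=
  ENNReal.toReal_pos ((Measure.mem_support_iff_forall c).1 hc _
    (Metric.closedBall_mem_nhds c hr)).ne' (measure_ne_top _ _)

theorem norm_integral_spectralExp_sq (t : ℝ) :
    ‖∫ l, spectralExp t l ∂ρ‖ ^ 2 = ∫ x, Real.cos ((x.1 - x.2) * t) ∂(ρ.prod ρ) := by
  have hprod : ((‖∫ l, spectralExp t l ∂ρ‖ ^ 2 : ℝ) : ℂ) =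
      ∫ x : ℝ × ℝ, spectralExp t x.1 * conj (spectralExp t x.2) ∂(ρ.prod ρ) := by
    push_cast
    rw [← Complex.mul_conj', ← integral_conj]
    exact (integral_prod_mul (fun l => spectralExp t l) (fun l => conj (spectralExp t l))).symm
  have hterm : ∀ x : ℝ × ℝ, (spectralExp t x.1 * conj (spectralExp t x.2)).re =
      Real.cos ((x.1 - x.2) * t) := fun x => by
    rw [conj_spectralExp, spectralExp, spectralExp, ← Complex.exp_add, ← Real.cos_neg,
      ← Complex.exp_ofReal_mul_I_re]
    congr 2
    push_cast
    ring
  have hi : Integrable (fun x : ℝ × ℝ => spectralExp t x.1 * conj (spectralExp t x.2))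
      (ρ.prod ρ) := by
    have hc := continuous_spectralExp t
    refine Integrable.of_bound (Continuous.aestronglyMeasurable (by fun_prop)) 1
      (.of_forall fun x => ?_)
    simp [norm_spectralExp]
  simp only [← hterm]
  exact (congrArg Complex.re hprod).trans (integral_re hi).symm

theorem one_sub_norm_integral_spectralExp_sq (t : ℝ) :
    1 - ‖∫ l, spectralExp t l ∂ρ‖ ^ 2 =
      ∫ x : ℝ × ℝ, (1 - Real.cos ((x.1 - x.2) * t)) ∂(ρ.prod ρ) := by
  rw [norm_integral_spectralExp_sq, integral_sub (integrable_const _)]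
  · simp
  · exact Integrable.of_bound (Continuous.aestronglyMeasurable (by fun_prop)) 1
      (.of_forall fun x => Real.abs_cos_le_one _)

theorem exists_mul_sq_le_one_sub_norm_integral_spectralExp_sq (hρ : ¬ IsDegenerate ρ) :
    ∃ κ > 0, ∃ τ > 0, ∀ t : ℝ, |t| ≤ τ →
      κ * t ^ 2 ≤ 1 - ‖∫ l, spectralExp t l ∂ρ‖ ^ 2 := by
  obtain ⟨a, ha, -⟩ := exists_mem_support_ne hρ 0
  obtain ⟨b, hb, hba⟩ := exists_mem_support_ne hρ a
  set d := |a - b|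
  have hd : 0 < d := abs_pos.2 (sub_ne_zero.2 hba.symm)
  set B := Metric.closedBall a (d / 4) ×ˢ Metric.closedBall b (d / 4)
  have hB : 0 < (ρ.prod ρ).real B := by
    rw [measureReal_prod_prod]
    exact mul_pos (measureReal_closedBall_pos_of_mem_support ha (by positivity))
      (measureReal_closedBall_pos_of_mem_support hb (by positivity))
  have hfar : ∀ x ∈ B, d / 2 ≤ |x.1 - x.2| ∧ |x.1 - x.2| ≤ 2 * d := by
    rintro x ⟨hx1, hx2⟩
    rw [Metric.mem_closedBall, Real.dist_eq] at hx1 hx2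
    have hdiff : |(x.1 - x.2) - (a - b)| ≤ d / 2 := by
      rw [sub_sub_sub_comm]
      linarith [abs_sub (x.1 - a) (x.2 - b)]
    have := abs_le.1 ((abs_abs_sub_abs_le _ _).trans hdiff)
    constructor <;> linarith
  refine ⟨2 / Real.pi ^ 2 * (d / 2) ^ 2 * (ρ.prod ρ).real B, by positivity,
    Real.pi / (2 * d), by positivity, fun t ht => ?_⟩
  rw [one_sub_norm_integral_spectralExp_sq, mul_right_comm]
  refine mul_measureReal_le_integral ?_ (fun x => sub_nonneg.2 (Real.cos_le_one _))
    (measurableSet_closedBall.prod measurableSet_closedBall) fun x hx => ?_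
  · exact (integrable_const _).sub (Integrable.of_bound
      (Continuous.aestronglyMeasurable (by fun_prop)) 1 (.of_forall fun x => Real.abs_cos_le_one _))
  have hpi : |(x.1 - x.2) * t| ≤ Real.pi := by
    rw [abs_mul]
    calc |x.1 - x.2| * |t| ≤ 2 * d * (Real.pi / (2 * d)) := by
          gcongr
          exact (hfar x hx).2
      _ = Real.pi := by field_simp
  have hsq : (d / 2) ^ 2 ≤ (x.1 - x.2) ^ 2 := by
    rw [← sq_abs (x.1 - x.2)]
    exact pow_le_pow_left₀ (by positivity) (hfar x hx).1 2
  calc 2 / Real.pi ^ 2 * (d / 2) ^ 2 * t ^ 2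
      ≤ 2 / Real.pi ^ 2 * (x.1 - x.2) ^ 2 * t ^ 2 := by gcongr
    _ = 2 / Real.pi ^ 2 * ((x.1 - x.2) * t) ^ 2 := by ring
    _ ≤ 1 - Real.cos ((x.1 - x.2) * t) := by linarith [Real.cos_le_one_sub_mul_cos_sq hpi]

end NonDegenerate

section TwoPoint

theorem rpow_mul_le_of_le {a b e : ℝ} (ha : 0 < a) (hab : a ≤ b) (he : 0 < e)
    (heab : e ≤ a + b) : (a * b) ^ (-(6 / 5) : ℝ) ≤
      2 * (e ^ (-(3 / 5) : ℝ) * a ^ (-(9 / 5) : ℝ)) := by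
  have hb : 0 < b := ha.trans_le hab
  have hba : b ^ (-(3 / 5) : ℝ) ≤ a ^ (-(3 / 5) : ℝ) :=
    Real.rpow_le_rpow_of_nonpos ha hab (by norm_num)
  have hbe : b ^ (-(3 / 5) : ℝ) ≤ (e / 2) ^ (-(3 / 5) : ℝ) :=
    Real.rpow_le_rpow_of_nonpos (by positivity) (by linarith) (by norm_num)
  have htwo : (2 : ℝ) ^ (3 / 5 : ℝ) ≤ 2 := by
    simpa using Real.rpow_le_rpow_of_exponent_le (x := 2) (by norm_num)
      (show (3 / 5 : ℝ) ≤ 1 by norm_num)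
  calc (a * b) ^ (-(6 / 5) : ℝ)
      = a ^ (-(6 / 5) : ℝ) * (b ^ (-(3 / 5) : ℝ) * b ^ (-(3 / 5) : ℝ)) := by
        rw [Real.mul_rpow ha.le hb.le, ← Real.rpow_add hb]
        norm_num
    _ ≤ a ^ (-(6 / 5) : ℝ) * (a ^ (-(3 / 5) : ℝ) * (e / 2) ^ (-(3 / 5) : ℝ)) := by gcongr
    _ = 2 ^ (3 / 5 : ℝ) * (e ^ (-(3 / 5) : ℝ) * a ^ (-(9 / 5) : ℝ)) := by
        rw [Real.div_rpow he.le zero_le_two, Real.rpow_neg zero_le_two, div_inv_eq_mul,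
          ← mul_assoc, ← Real.rpow_add ha]
        norm_num
        ring
    _ ≤ 2 * (e ^ (-(3 / 5) : ℝ) * a ^ (-(9 / 5) : ℝ)) := by gcongr

theorem rpow_mul_le_of_le_add {x y d e : ℝ} (hx : 0 < x) (hy : 0 < y) (hd : 0 < d) (he : 0 < e)
    (hdxy : d ≤ x + y) (hexy : e ≤ x + y) : (x * y) ^ (-(6 / 5) : ℝ) ≤
      2 * (d ^ (-(3 / 5) : ℝ) * x ^ (-(9 / 5) : ℝ)) +
        2 * (e ^ (-(3 / 5) : ℝ) * y ^ (-(9 / 5) : ℝ)) := by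
  rcases le_total x y with hxy | hyx
  · exact (rpow_mul_le_of_le hx hxy hd hdxy).trans (le_add_of_nonneg_right (by positivity))
  · rw [mul_comm x]
    exact (rpow_mul_le_of_le hy hyx he (by linarith)).trans
      (le_add_of_nonneg_left (by positivity))

theorem div_mul_div_le {a b x y : ℝ} (ha : 0 ≤ a) (hb : 0 ≤ b) (hx : 0 < x) (hy : 0 < y) :
    a / x * (b / y) ≤ a ^ (12 : ℝ) + b ^ (12 : ℝ) + (x * y) ^ (-(6 / 5) : ℝ) := by
  have hyoung := Real.young_inequality_of_nonneg (a := a * b) (b := (x * y)⁻¹) (p := 6)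
    (q := 6 / 5) (by positivity) (by positivity) (by rw [Real.holderConjugate_iff]; norm_num)
  rw [Real.inv_rpow (by positivity), ← Real.rpow_neg (by positivity),
    ← div_eq_mul_inv, ← div_mul_div_comm] at hyoung
  have hab : (a * b) ^ (6 : ℝ) ≤ a ^ (12 : ℝ) + b ^ (12 : ℝ) := by
    norm_cast
    nlinarith [sq_nonneg (a ^ 6 - b ^ 6), pow_nonneg ha 12, pow_nonneg hb 12]
  have hab0 : 0 ≤ (a * b) ^ (6 : ℝ) := by positivity
  have hxy0 : 0 ≤ (x * y) ^ (-(6 / 5) : ℝ) := by positivity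
  linarith

theorem norm_div_mul_norm_div_le {z z' w w' c : ℂ} (hz : z ≠ 0) (hz' : z' ≠ 0) (hc : ‖c‖ ≤ 1)
    (hres : z' - c * z ≠ 0) (hres' : z - conj c * z' ≠ 0) :
    ‖w / z‖ * ‖w' / z'‖ ≤ ‖w‖ ^ (12 : ℝ) + ‖w'‖ ^ (12 : ℝ) +
      (2 * (‖z' - c * z‖ ^ (-(3 / 5) : ℝ) * ‖z‖ ^ (-(9 / 5) : ℝ)) +
        2 * (‖z - conj c * z'‖ ^ (-(3 / 5) : ℝ) * ‖z'‖ ^ (-(9 / 5) : ℝ))) := by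
  have htri : ∀ {x y a : ℂ}, ‖a‖ ≤ 1 → ‖x - a * y‖ ≤ ‖x‖ + ‖y‖ := fun {x y a} ha =>
    (norm_sub_le _ _).trans (by rw [norm_mul]; nlinarith [norm_nonneg y])
  have hz0 := norm_pos_iff.2 hz
  have hz0' := norm_pos_iff.2 hz'
  rw [norm_div, norm_div]
  refine (div_mul_div_le (norm_nonneg _) (norm_nonneg _) hz0 hz0').trans ?_
  gcongr
  exact rpow_mul_le_of_le_add hz0 hz0' (norm_pos_iff.2 hres) (norm_pos_iff.2 hres')
    ((htri hc).trans_eq (add_comm _ _)) (htri (by rwa [RCLike.norm_conj]))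

variable {Ω E : Type*} [MeasurableSpace E] {ρ : Measure E}
  {S : Submodule ℂ ((Ω → ℂ) × (E → ℂ))} {p q : (Ω → ℂ) × (E → ℂ)}

theorem integral_norm_sub_proj_sq {f g : E → ℂ} (hf : MemLp f 2 ρ) (hg : MemLp g 2 ρ)
    (hf1 : ∫ x, ‖f x‖ ^ 2 ∂ρ = 1) :
    ∫ x, ‖(g - (∫ y, g y * conj (f y) ∂ρ) • f) x‖ ^ 2 ∂ρ =
      ∫ x, ‖g x‖ ^ 2 ∂ρ - ‖∫ x, g x * conj (f x) ∂ρ‖ ^ 2 := by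
  set c := ∫ x, g x * conj (f x) ∂ρ
  have horth : ∫ x, f x * conj (g x - c * f x) ∂ρ = 0 :=
    integral_mul_conj_sub_proj_eq_zero hf hg hf1
  have hsum := integral_norm_add_sq (hf.const_smul c) (hg.sub (hf.const_smul c))
  simp only [Pi.smul_apply, smul_eq_mul, mul_assoc, integral_const_mul, norm_mul, mul_pow, hf1,
    Pi.sub_apply, add_sub_cancel, horth, mul_zero, Complex.zero_re] at hsum ⊢
  linarith

namespace IsIsonormal

variable [MeasurableSpace Ω] {P : Measure Ω} [IsProbabilityMeasure P]

theorem ae_ne_zero (hS : IsIsonormal P ρ S) (hp : p ∈ S) (h : 0 < ∫ x, ‖p.2 x‖ ^ 2 ∂ρ) :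
    ∀ᵐ ω ∂P, p.1 ω ≠ 0 := by
  have hm : MeasurableSet {z : ℂ | z ≠ 0} := (measurableSet_singleton 0).compl
  refine ae_of_ae_map (p := fun z => z ≠ 0) (hS.aemeasurable_fst hp) ?_
  rw [hS.map_eq hp, ae_map_iff (by fun_prop) hm]
  exact ae_ne_zero_stdComplexGaussian.mono fun z hz => smul_ne_zero (Real.sqrt_pos.2 h).ne' hz

theorem integrable_norm_rpow (hS : IsIsonormal P ρ S) (hp : p ∈ S) {a : ℝ} (ha : -2 < a) :
    Integrable (fun ω => ‖p.1 ω‖ ^ a) P := by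
  have hm : Measurable fun z : ℂ => ‖z‖ ^ a := by fun_prop
  refine Integrable.comp_aemeasurable (g := fun z : ℂ => ‖z‖ ^ a) ?_ (hS.aemeasurable_fst hp)
  rw [hS.map_eq hp, integrable_map_measure hm.aestronglyMeasurable (by fun_prop)]
  simpa only [Function.comp_def, norm_smul, Real.mul_rpow (norm_nonneg _) (norm_nonneg _)]
    using (integrable_norm_rpow_stdComplexGaussian ha).const_mul _

theorem integral_norm_rpow (hS : IsIsonormal P ρ S) (hp : p ∈ S) {a : ℝ} (ha : -2 < a) :
    ∫ ω, ‖p.1 ω‖ ^ a ∂P = √(∫ x, ‖p.2 x‖ ^ 2 ∂ρ) ^ a * Real.Gamma (a / 2 + 1) := by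
  have hm : Measurable fun z : ℂ => ‖z‖ ^ a := by fun_prop
  rw [← integral_norm_rpow_stdComplexGaussian ha,
    ← integral_map (hS.aemeasurable_fst hp) hm.aestronglyMeasurable, hS.map_eq hp,
    integral_map (by fun_prop) hm.aestronglyMeasurable]
  simp only [norm_smul, Real.norm_of_nonneg (Real.sqrt_nonneg _),
    Real.mul_rpow (Real.sqrt_nonneg _) (norm_nonneg _)]
  rw [integral_const_mul]

theorem integral_norm_rpow_mul_norm_rpow (hS : IsIsonormal P ρ S) (hp : p ∈ S) (hq : q ∈ S)
    (horth : ∫ x, p.2 x * conj (q.2 x) ∂ρ = 0) {a b : ℝ} (ha : -2 < a) (hb : -2 < b) :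
    Integrable (fun ω => ‖q.1 ω‖ ^ a * ‖p.1 ω‖ ^ b) P ∧
      ∫ ω, ‖q.1 ω‖ ^ a * ‖p.1 ω‖ ^ b ∂P =
        (∫ ω, ‖q.1 ω‖ ^ a ∂P) * ∫ ω, ‖p.1 ω‖ ^ b ∂P := by
  have hqa := hS.integrable_norm_rpow hq ha
  have hpb := hS.integrable_norm_rpow hp hb
  have hind : IndepFun (fun ω => ‖q.1 ω‖ ^ a) (fun ω => ‖p.1 ω‖ ^ b) P :=
    (hS.indepFun (ι := Unit) (q := fun _ => q) hp (fun _ => hq) fun _ => horth).symm.comp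
      (φ := fun y : Unit → ℂ => ‖y ()‖ ^ a) (ψ := fun z : ℂ => ‖z‖ ^ b) (by fun_prop)
      (by fun_prop)
  exact ⟨hind.integrable_mul hqa hpb, hind.integral_fun_mul_eq_mul_integral
    hqa.aestronglyMeasurable hpb.aestronglyMeasurable⟩

theorem integral_norm_residual_rpow_mul_le (hS : IsIsonormal P ρ S) (hp : p ∈ S) (hq : q ∈ S)
    (hp1 : ∫ x, ‖p.2 x‖ ^ 2 ∂ρ = 1) (hq1 : ∫ x, ‖q.2 x‖ ^ 2 ∂ρ = 1) {c : ℂ}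
    (hc : ∫ x, q.2 x * conj (p.2 x) ∂ρ = c) {β : ℝ} (hβ : 0 < β) (hβc : β ^ 2 ≤ 1 - ‖c‖ ^ 2) :
    (∀ᵐ ω ∂P, q.1 ω - c * p.1 ω ≠ 0) ∧
    Integrable (fun ω => ‖q.1 ω - c * p.1 ω‖ ^ (-(3 / 5) : ℝ) * ‖p.1 ω‖ ^ (-(9 / 5) : ℝ)) P ∧
    ∫ ω, ‖q.1 ω - c * p.1 ω‖ ^ (-(3 / 5) : ℝ) * ‖p.1 ω‖ ^ (-(9 / 5) : ℝ) ∂P ≤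
      β ^ (-(3 / 5) : ℝ) * (Real.Gamma (7 / 10) * Real.Gamma (1 / 10)) := by
  subst hc
  have hp2 := hS.memLp_snd hp
  have hq2 := hS.memLp_snd hq
  have hmem := S.sub_mem hq (S.smul_mem (∫ x, q.2 x * conj (p.2 x) ∂ρ) hp)
  have hvar := integral_norm_sub_proj_sq hp2 hq2 hp1
  rw [hq1] at hvar
  obtain ⟨hi, heq⟩ := hS.integral_norm_rpow_mul_norm_rpow hp hmem
    (integral_mul_conj_sub_proj_eq_zero hp2 hq2 hp1) (a := -(3 / 5)) (b := -(9 / 5))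
    (by norm_num) (by norm_num)
  refine ⟨hS.ae_ne_zero hmem (by rw [Prod.snd_sub, Prod.smul_snd, hvar]; nlinarith), hi,
    heq.trans_le ?_⟩
  rw [hS.integral_norm_rpow hmem (by norm_num), hS.integral_norm_rpow hp (by norm_num), hp1,
    Prod.snd_sub, Prod.smul_snd, hvar, Real.sqrt_one, Real.one_rpow, one_mul, mul_assoc]
  norm_num only
  refine mul_le_mul_of_nonneg_right (Real.rpow_le_rpow_of_nonpos hβ
    (Real.le_sqrt_of_sq_le hβc) (by norm_num)) ?_
  exact mul_nonneg (Real.Gamma_nonneg_of_nonneg (by norm_num))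
    (Real.Gamma_nonneg_of_nonneg (by norm_num))

variable {z z' w w' : (Ω → ℂ) × (E → ℂ)}

-- On the event that `z` is the smaller of the two denominators, `z'` is at least half as large as
-- the part of `z'` orthogonal to `z`, which is independent of `z`.
theorem lintegral_two_point_le (hS : IsIsonormal P ρ S) (hz : z ∈ S) (hz' : z' ∈ S) (hw : w ∈ S)
    (hw' : w' ∈ S) (hz1 : ∫ x, ‖z.2 x‖ ^ 2 ∂ρ = 1) (hz1' : ∫ x, ‖z'.2 x‖ ^ 2 ∂ρ = 1) {v : ℝ}
    (hv : ∫ x, ‖w.2 x‖ ^ 2 ∂ρ = v) (hv' : ∫ x, ‖w'.2 x‖ ^ 2 ∂ρ = v)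
    {β : ℝ} (hβ : 0 < β) (hβc : β ^ 2 ≤ 1 - ‖∫ x, z'.2 x * conj (z.2 x) ∂ρ‖ ^ 2) :
    ∫⁻ ω, ‖w.1 ω / z.1 ω‖ₑ * ‖w'.1 ω / z'.1 ω‖ₑ ∂P ≤
      ENNReal.ofReal (2 * (√v ^ (12 : ℝ) * Real.Gamma 7) +
        4 * (Real.Gamma (7 / 10) * Real.Gamma (1 / 10)) * β ^ (-(3 / 5) : ℝ)) := by
  set c := ∫ x, z'.2 x * conj (z.2 x) ∂ρ with hc
  have hc' : ∫ x, z.2 x * conj (z'.2 x) ∂ρ = conj c := by simp [hc, ← integral_conj, mul_comm]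
  have hc1 : ‖c‖ ≤ 1 := by nlinarith [norm_nonneg c]
  obtain ⟨hres, hi, hle⟩ :=
    hS.integral_norm_residual_rpow_mul_le hz hz' hz1 hz1' hc.symm hβ hβc
  obtain ⟨hres', hi', hle'⟩ := hS.integral_norm_residual_rpow_mul_le hz' hz hz1' hz1 hc' hβ
    (by rwa [RCLike.norm_conj])
  have hwi := hS.integrable_norm_rpow hw (a := 12) (by norm_num)
  have hwi' := hS.integrable_norm_rpow hw' (a := 12) (by norm_num)
  have hw2 := hwi.fun_add hwi'
  have hr2 := (hi.const_mul 2).fun_add (hi'.const_mul 2)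
  have hbound : ∀ᵐ ω ∂P, ‖w.1 ω / z.1 ω‖ₑ * ‖w'.1 ω / z'.1 ω‖ₑ ≤ ENNReal.ofReal
      (‖w.1 ω‖ ^ (12 : ℝ) + ‖w'.1 ω‖ ^ (12 : ℝ) +
        (2 * (‖z'.1 ω - c * z.1 ω‖ ^ (-(3 / 5) : ℝ) * ‖z.1 ω‖ ^ (-(9 / 5) : ℝ)) +
          2 * (‖z.1 ω - conj c * z'.1 ω‖ ^ (-(3 / 5) : ℝ) * ‖z'.1 ω‖ ^ (-(9 / 5) : ℝ)))) := by
    filter_upwards [hres, hres', hS.ae_ne_zero hz (by simp [hz1]),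
      hS.ae_ne_zero hz' (by simp [hz1'])] with ω h h' h0 h0'
    rw [← enorm_mul, ← ofReal_norm, norm_mul]
    exact ENNReal.ofReal_le_ofReal (norm_div_mul_norm_div_le h0 h0' hc1 h h')
  refine (lintegral_mono_ae hbound).trans ?_
  rw [← ofReal_integral_eq_lintegral_ofReal (hw2.fun_add hr2) (.of_forall fun ω => by positivity)]
  refine ENNReal.ofReal_le_ofReal ?_
  rw [integral_add hw2 hr2, integral_add hwi hwi', integral_add (hi.const_mul 2)
    (hi'.const_mul 2), integral_const_mul, integral_const_mul,
    hS.integral_norm_rpow hw (by norm_num), hS.integral_norm_rpow hw' (by norm_num), hv, hv']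
  norm_num only at hle hle' ⊢
  linarith

end IsIsonormal

end TwoPoint

section TimeIntegrals

open scoped ENNReal

theorem add_sq_le_two_mul (a b : ℝ≥0∞) : (a + b) ^ 2 ≤ 2 * (a ^ 2 + b ^ 2) := by
  have h := ENNReal.rpow_add_le_mul_rpow_add_rpow a b one_le_two
  norm_num at h
  exact h

theorem mul_le_sq_add_sq (a b : ℝ≥0∞) : a * b ≤ a ^ 2 + b ^ 2 := by
  rcases le_total a b with h | h
  · exact (mul_le_mul_left h b).trans ((sq b).symm.trans_le le_add_self)
  · exact (mul_le_mul_right h a).trans ((sq a).symm.trans_le le_self_add)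

theorem integrableOn_abs_rpow (τ : ℝ) {q : ℝ} (hq : -1 < q) :
    IntegrableOn (fun u : ℝ => |u| ^ q) (Set.Icc (-τ) τ) := by
  rcases lt_or_ge τ 0 with hτ | hτ
  · simp [Set.Icc_eq_empty_of_lt (show τ < -τ by linarith)]
  have hpos : IntervalIntegrable (fun u : ℝ => |u| ^ q) volume 0 τ := by
    refine (intervalIntegral.intervalIntegrable_rpow' hq).congr fun u hu => ?_
    rw [Set.uIoc_of_le hτ] at hu
    simp only [abs_of_pos hu.1]
  have hneg : IntervalIntegrable (fun u : ℝ => |u| ^ q) volume (-τ) 0 := by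
    simpa using ((IntervalIntegrable.iff_comp_neg).1 hpos).symm
  exact (intervalIntegrable_iff_integrableOn_Icc_of_le (by linarith)).1 (hneg.trans hpos)

variable {Ω α : Type*} [MeasurableSpace Ω] [MeasurableSpace α] {P : Measure Ω} {μ : Measure α}
  [SFinite μ]

theorem lintegral_sq_lintegral [SFinite P] {Y : α → Ω → ℝ≥0∞}
    (hY : Measurable (Function.uncurry Y)) :
    ∫⁻ ω, (∫⁻ s, Y s ω ∂μ) ^ 2 ∂P = ∫⁻ s, ∫⁻ t, ∫⁻ ω, Y s ω * Y t ω ∂P ∂μ ∂μ := by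
  have hYω : ∀ ω, Measurable fun s => Y s ω := fun ω => by fun_prop
  have hst : Measurable fun x : (Ω × α) × α => Y x.1.2 x.1.1 * Y x.2 x.1.1 := by fun_prop
  calc ∫⁻ ω, (∫⁻ s, Y s ω ∂μ) ^ 2 ∂P
      = ∫⁻ ω, ∫⁻ s, ∫⁻ t, Y s ω * Y t ω ∂μ ∂μ ∂P := by
        simp only [sq, lintegral_lintegral_mul (hYω _).aemeasurable (hYω _).aemeasurable]
    _ = ∫⁻ s, ∫⁻ ω, ∫⁻ t, Y s ω * Y t ω ∂μ ∂P ∂μ :=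
        lintegral_lintegral_swap hst.lintegral_prod_right'.aemeasurable
    _ = ∫⁻ s, ∫⁻ t, ∫⁻ ω, Y s ω * Y t ω ∂P ∂μ ∂μ := by
        refine lintegral_congr fun s => lintegral_lintegral_swap (Measurable.aemeasurable ?_)
        simp only [Function.uncurry_def]
        fun_prop

theorem memLp_two_integral {X : α → Ω → ℝ} (hX : Measurable (Function.uncurry X))
    (h : ∫⁻ ω, (∫⁻ s, ‖X s ω‖ₑ ∂μ) ^ 2 ∂P < ∞) :
    MemLp (fun ω => ∫ s, X s ω ∂μ) 2 P := by
  have hm : StronglyMeasurable fun x : Ω × α => X x.2 x.1 :=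
    (hX.comp measurable_swap).stronglyMeasurable
  refine ⟨hm.integral_prod_right'.aestronglyMeasurable, ?_⟩
  rw [eLpNorm_lt_top_iff_lintegral_rpow_enorm_lt_top (by simp) (by simp)]
  refine lt_of_le_of_lt (lintegral_mono fun ω => ?_) h
  simp only [ENNReal.toReal_ofNat, ENNReal.rpow_ofNat]
  gcongr
  exact enorm_integral_le_lintegral_enorm _

theorem integral_integral_mul_integral [SFinite P] {X Y : α → Ω → ℝ}
    (hX : Measurable (Function.uncurry X)) (hY : Measurable (Function.uncurry Y))
    (hX2 : ∫⁻ ω, (∫⁻ s, ‖X s ω‖ₑ ∂μ) ^ 2 ∂P < ∞) (hY2 : ∫⁻ ω, (∫⁻ s, ‖Y s ω‖ₑ ∂μ) ^ 2 ∂P < ∞) :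
    ∫ ω, (∫ s, X s ω ∂μ) * (∫ s, Y s ω ∂μ) ∂P =
      ∫ x, (∫ ω, X x.1 ω * Y x.2 ω ∂P) ∂(μ.prod μ) := by
  have hXY : Measurable fun x : Ω × (α × α) => X x.2.1 x.1 * Y x.2.2 x.1 := by fun_prop
  have hXm : Measurable fun ω => (∫⁻ s, ‖X s ω‖ₑ ∂μ) ^ 2 :=
    (hX.enorm.lintegral_prod_left').pow_const 2
  simp only [← integral_prod_mul]
  refine integral_integral_swap ⟨hXY.aestronglyMeasurable, hasFiniteIntegral_iff_enorm.2 ?_⟩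
  refine (lintegral_prod _ hXY.enorm.aemeasurable).trans_lt ?_
  calc ∫⁻ ω, ∫⁻ x : α × α, ‖X x.1 ω * Y x.2 ω‖ₑ ∂(μ.prod μ) ∂P
      = ∫⁻ ω, (∫⁻ s, ‖X s ω‖ₑ ∂μ) * (∫⁻ s, ‖Y s ω‖ₑ ∂μ) ∂P := by
        refine lintegral_congr fun ω => ?_
        have hXω : Measurable fun s => ‖X s ω‖ₑ := by fun_prop
        have hYω : Measurable fun s => ‖Y s ω‖ₑ := by fun_prop
        simp only [enorm_mul, lintegral_prod_mul hXω.aemeasurable hYω.aemeasurable]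
    _ ≤ ∫⁻ ω, ((∫⁻ s, ‖X s ω‖ₑ ∂μ) ^ 2 + (∫⁻ s, ‖Y s ω‖ₑ ∂μ) ^ 2) ∂P :=
        lintegral_mono fun ω => mul_le_sq_add_sq _ _
    _ < ∞ := by
        rw [lintegral_add_left hXm]
        exact ENNReal.add_lt_top.2 ⟨hX2, hY2⟩

theorem setLIntegral_sub_le {G : ℝ → ℝ≥0∞} (hG : Measurable G) {I : Set ℝ} {s τ : ℝ}
    (hI : ∀ t ∈ I, |s - t| ≤ τ) : ∫⁻ t in I, G (s - t) ≤ ∫⁻ u in Set.Icc (-τ) τ, G u := by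
  rw [← (Measure.measurePreserving_sub_left volume s).setLIntegral_comp_preimage
    measurableSet_Icc hG]
  exact lintegral_mono_set fun t ht => abs_le.1 (hI t ht)

variable {Y : ℝ → Ω → ℝ≥0∞} {G : ℝ → ℝ≥0∞} {τ : ℝ}

theorem lintegral_sq_setLIntegral_closedBall_lt_top [SFinite P]
    (hY : Measurable (Function.uncurry Y)) (hG : Measurable G)
    (hGτ : ∫⁻ u in Set.Icc (-τ) τ, G u < ∞)
    (hYG : ∀ s t, s ≠ t → |s - t| ≤ τ → ∫⁻ ω, Y s ω * Y t ω ∂P ≤ G (s - t)) (c : ℝ) :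
    ∫⁻ ω, (∫⁻ s in Metric.closedBall c (τ / 2), Y s ω) ^ 2 ∂P < ∞ := by
  set B := Metric.closedBall c (τ / 2)
  have hdist : ∀ s ∈ B, ∀ t ∈ B, |s - t| ≤ τ := fun s hs t ht =>
    (dist_triangle_right s t c).trans ((add_le_add hs ht).trans_eq (add_halves τ))
  rw [lintegral_sq_lintegral hY]
  calc ∫⁻ s in B, ∫⁻ t in B, ∫⁻ ω, Y s ω * Y t ω ∂P
      ≤ ∫⁻ s in B, ∫⁻ t in B, G (s - t) := by
        refine setLIntegral_mono' measurableSet_closedBall fun s hs => lintegral_mono_ae ?_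
        filter_upwards [ae_restrict_mem measurableSet_closedBall,
          ae_restrict_of_ae (Measure.ae_ne volume s)] with t ht hts
        exact hYG s t hts.symm (hdist s hs t ht)
    _ ≤ ∫⁻ _ in B, ∫⁻ u in Set.Icc (-τ) τ, G u :=
        setLIntegral_mono' measurableSet_closedBall fun s hs => setLIntegral_sub_le hG (hdist s hs)
    _ < ∞ := by
        rw [setLIntegral_const]
        exact ENNReal.mul_lt_top hGτ measure_closedBall_lt_top

theorem lintegral_sq_setLIntegral_lt_top [SFinite P] (hτ : 0 < τ)
    (hY : Measurable (Function.uncurry Y)) (hG : Measurable G)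
    (hGτ : ∫⁻ u in Set.Icc (-τ) τ, G u < ∞)
    (hYG : ∀ s t, s ≠ t → |s - t| ≤ τ → ∫⁻ ω, Y s ω * Y t ω ∂P ≤ G (s - t))
    {K : Set ℝ} (hK : IsCompact K) :
    ∫⁻ ω, (∫⁻ s in K, Y s ω) ^ 2 ∂P < ∞ := by
  refine hK.induction_on (p := fun I => ∫⁻ ω, (∫⁻ s in I, Y s ω) ^ 2 ∂P < ∞) (by simp)
    (fun I J hIJ hJ => ?_) (fun I J hI hJ => ?_) fun c _ =>
      ⟨_, mem_nhdsWithin_of_mem_nhds (Metric.closedBall_mem_nhds c (half_pos hτ)),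
        lintegral_sq_setLIntegral_closedBall_lt_top hY hG hGτ hYG c⟩
  · refine lt_of_le_of_lt (lintegral_mono fun ω => ?_) hJ
    gcongr
  · have hIm : Measurable fun ω => (∫⁻ s in I, Y s ω) ^ 2 := (hY.lintegral_prod_left').pow_const 2
    calc ∫⁻ ω, (∫⁻ s in I ∪ J, Y s ω) ^ 2 ∂P
        ≤ ∫⁻ ω, 2 * ((∫⁻ s in I, Y s ω) ^ 2 + (∫⁻ s in J, Y s ω) ^ 2) ∂P := by
          refine lintegral_mono fun ω => le_trans ?_ (add_sq_le_two_mul _ _)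
          gcongr
          exact lintegral_union_le _ _ _
      _ < ∞ := by
          rw [lintegral_const_mul' _ _ (by simp), lintegral_add_left hIm]
          exact ENNReal.mul_lt_top (by simp) (ENNReal.add_lt_top.2 ⟨hI, hJ⟩)

end TimeIntegrals

section NearDiagonal

variable {α ι : Type*} [MeasurableSpace α] {μ : Measure α} [IsFiniteMeasure μ]
  [MeasurableSpace ι] [MeasurableSingletonClass ι]

theorem sq_measureReal_le_card_mul_prod_fiber {A : Set α} (hA : MeasurableSet A) {g : α → ι}
    (hg : Measurable g) {s : Finset ι} (hgA : ∀ x ∈ A, g x ∈ s) :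
    μ.real A ^ 2 ≤
      s.card * (μ.prod μ).real {x | x.1 ∈ A ∧ x.2 ∈ A ∧ g x.1 = g x.2} := by
  set B : ι → Set α := fun j => A ∩ g ⁻¹' {j}
  have hBm : ∀ j ∈ s, MeasurableSet (B j) := fun j _ => hA.inter (hg (measurableSet_singleton j))
  have hdisj : (s : Set ι).PairwiseDisjoint B := fun i _ j _ hij =>
    ((Set.disjoint_singleton.2 hij).preimage g).mono Set.inter_subset_right Set.inter_subset_right
  have hdisj2 : (s : Set ι).PairwiseDisjoint fun j => B j ×ˢ B j := fun i hi j hj hij =>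
    Set.disjoint_prod.2 (.inl (hdisj hi hj hij))
  have hA' : A = ⋃ j ∈ s, B j := by
    ext x
    simpa [B] using hgA x
  have hsub : ⋃ j ∈ s, B j ×ˢ B j ⊆ {x | x.1 ∈ A ∧ x.2 ∈ A ∧ g x.1 = g x.2} := by
    refine Set.iUnion₂_subset fun j _ x hx => ?_
    exact ⟨hx.1.1, hx.2.1, hx.1.2.trans hx.2.2.symm⟩
  calc μ.real A ^ 2 = (∑ j ∈ s, μ.real (B j)) ^ 2 := by
        rw [← measureReal_biUnion_finset hdisj hBm, ← hA']
    _ ≤ s.card * ∑ j ∈ s, μ.real (B j) ^ 2 := sq_sum_le_card_mul_sum_sq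
    _ = s.card * (μ.prod μ).real (⋃ j ∈ s, B j ×ˢ B j) := by
        rw [measureReal_biUnion_finset hdisj2 fun j hj => (hBm j hj).prod (hBm j hj)]
        simp only [measureReal_prod_prod, sq]
    _ ≤ _ := mul_le_mul_of_nonneg_left (measureReal_mono hsub) (Nat.cast_nonneg _)

theorem sq_measureReal_div_le_prod_near_diag {ρ : Measure ℝ} [IsFiniteMeasure ρ] {A : Set ℝ}
    (hA : MeasurableSet A) {a R T : ℝ} (hAR : A ⊆ Set.Icc a (a + R)) (hR : 0 ≤ R) (hT : 1 ≤ T) :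
    ρ.real A ^ 2 / ((R + 1) * T) ≤
      (ρ.prod ρ).real {x | x.1 ∈ A ∧ x.2 ∈ A ∧ |x.1 - x.2| ≤ T⁻¹} := by
  have hT0 : 0 < T := one_pos.trans_le hT
  have hcells := sq_measureReal_le_card_mul_prod_fiber (μ := ρ) hA
    (g := fun x => ⌊(x - a) * T⌋₊) (by fun_prop) (s := Finset.range (⌊R * T⌋₊ + 1)) fun x hx => by
      rw [Finset.mem_range, Nat.lt_succ_iff]
      gcongr
      linarith [(hAR hx).2]
  have hcard : ((⌊R * T⌋₊ + 1 : ℕ) : ℝ) ≤ (R + 1) * T := by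
    push_cast
    linarith [Nat.floor_le (show 0 ≤ R * T by positivity)]
  have hclose : ∀ x ∈ A, ∀ y ∈ A, ⌊(x - a) * T⌋₊ = ⌊(y - a) * T⌋₊ → |x - y| ≤ T⁻¹ := by
    intro x hx y hy hxy
    have hnn : ∀ z ∈ A, 0 ≤ (z - a) * T := fun z hz =>
      mul_nonneg (sub_nonneg.2 (hAR hz).1) hT0.le
    have hfloor : |(x - a) * T - (y - a) * T| ≤ 1 := by
      obtain ⟨lx, ux⟩ := (Nat.floor_eq_iff (hnn x hx)).1 hxy
      obtain ⟨ly, uy⟩ := (Nat.floor_eq_iff (hnn y hy)).1 rfl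
      exact abs_le.2 ⟨by linarith, by linarith⟩
    rwa [← sub_mul, sub_sub_sub_cancel_right, abs_mul, abs_of_pos hT0, ← le_div_iff₀ hT0,
      one_div] at hfloor
  rw [Finset.card_range] at hcells
  rw [div_le_iff₀' (by positivity)]
  refine hcells.trans (mul_le_mul hcard (measureReal_mono ?_) measureReal_nonneg (by positivity))
  exact fun x hx => ⟨hx.1, hx.2.1, hclose _ hx.1 _ hx.2.1 hx.2.2⟩

end NearDiagonal

section SpectralLowerBound

theorem integrable_cos {α : Type*} [MeasurableSpace α] {μ : Measure α} [IsFiniteMeasure μ]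
    {g : α → ℝ} (hg : Measurable g) : Integrable (fun x => Real.cos (g x)) μ :=
  Integrable.of_bound (by fun_prop) 1 (.of_forall fun x => Real.abs_cos_le_one _)

theorem integrable_sin {α : Type*} [MeasurableSpace α] {μ : Measure α} [IsFiniteMeasure μ]
    {g : α → ℝ} (hg : Measurable g) : Integrable (fun x => Real.sin (g x)) μ :=
  Integrable.of_bound (by fun_prop) 1 (.of_forall fun x => Real.abs_sin_le_one _)

/-- The double integral of `cos (x * (s - t))` over `(s, t) ∈ (0, T]²`. It equals
`(2 * sin (x * T / 2) / x) ^ 2` for `x ≠ 0`, a multiple of the Fejér kernel. -/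
noncomputable def cosKernel (T x : ℝ) : ℝ :=
  ∫ y : ℝ × ℝ, Real.cos (x * (y.1 - y.2))
    ∂((volume.restrict (Set.Ioc 0 T)).prod (volume.restrict (Set.Ioc 0 T)))

theorem cosKernel_eq (T x : ℝ) :
    cosKernel T x = (∫ s in Set.Ioc 0 T, Real.cos (x * s)) ^ 2 +
      (∫ s in Set.Ioc 0 T, Real.sin (x * s)) ^ 2 := by
  have hc : Integrable (fun s => Real.cos (x * s)) (volume.restrict (Set.Ioc 0 T)) :=
    integrable_cos (by fun_prop)
  have hs : Integrable (fun s => Real.sin (x * s)) (volume.restrict (Set.Ioc 0 T)) :=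
    integrable_sin (by fun_prop)
  simp only [cosKernel, mul_sub, Real.cos_sub]
  rw [integral_add (hc.mul_prod hc) (hs.mul_prod hs),
    integral_prod_mul (fun s => Real.cos (x * s)) (fun s => Real.cos (x * s)),
    integral_prod_mul (fun s => Real.sin (x * s)) (fun s => Real.sin (x * s)), sq, sq]

theorem cosKernel_nonneg (T x : ℝ) : 0 ≤ cosKernel T x := by
  rw [cosKernel_eq]
  positivity

theorem sq_div_four_le_cosKernel {T x : ℝ} (hT : 0 < T) (hx : |x| ≤ T⁻¹) :
    T ^ 2 / 4 ≤ cosKernel T x := by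
  have hcos : ∀ s ∈ Set.Ioc 0 T, 1 / 2 ≤ Real.cos (x * s) := fun s hs => by
    have hxs : |x * s| ≤ 1 := by
      rw [abs_mul, abs_of_pos hs.1, ← inv_mul_cancel₀ hT.ne']
      exact mul_le_mul hx hs.2 hs.1.le (by positivity)
    linarith [Real.one_sub_sq_div_two_le_cos (x := x * s), (sq_le_one_iff_abs_le_one _).2 hxs]
  have hint : T / 2 ≤ ∫ s in Set.Ioc 0 T, Real.cos (x * s) := by
    refine le_trans (le_of_eq ?_) (setIntegral_ge_of_const_le_real measurableSet_Ioc (by simp) hcos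
      (integrable_cos (by fun_prop)))
    rw [Real.volume_real_Ioc_of_le hT.le]
    ring
  rw [cosKernel_eq]
  nlinarith [sq_nonneg (∫ s in Set.Ioc 0 T, Real.sin (x * s))]

variable {ρ : Measure ℝ} [IsProbabilityMeasure ρ]

theorem integrable_quadratic_prod (hρ : MemLp (fun l : ℝ => l) 2 ρ) (φ : ℝ) :
    Integrable (fun x : ℝ × ℝ => (x.1 + x.2 - 2 * φ) ^ 2) (ρ.prod ρ) :=
  (((hρ.comp_fst ρ).add (hρ.comp_snd ρ)).sub (memLp_const (2 * φ))).integrable_sq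

theorem integrable_quadratic_prod_mul_cosKernel (hρ : MemLp (fun l : ℝ => l) 2 ρ) (φ T : ℝ) :
    Integrable (fun x : ℝ × ℝ => (x.1 + x.2 - 2 * φ) ^ 2 * cosKernel T (x.1 - x.2))
      (ρ.prod ρ) := by
  have hm : StronglyMeasurable fun z : (ℝ × ℝ) × (ℝ × ℝ) =>
      Real.cos ((z.1.1 - z.1.2) * (z.2.1 - z.2.2)) := Continuous.stronglyMeasurable (by fun_prop)
  exact (integrable_quadratic_prod hρ φ).mul_bdd hm.integral_prod_right'.aestronglyMeasurable
    (.of_forall fun x =>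
      norm_integral_le_of_norm_le_const (C := 1) (.of_forall fun y => Real.abs_cos_le_one _))

/-- The covariance function of the stationary process `Im ((f' + i φ f) * conj f)`, where `f` is
the Gaussian process with spectral measure `ρ`. -/
noncomputable def quadraticKernel (ρ : Measure ℝ) (φ τ : ℝ) : ℝ :=
  (∫ x : ℝ × ℝ, (x.1 + x.2 - 2 * φ) ^ 2 * Real.cos ((x.1 - x.2) * τ) ∂(ρ.prod ρ)) / 4

theorem integral_quadraticKernel (hρ : MemLp (fun l : ℝ => l) 2 ρ) (φ T : ℝ) :
    ∫ y : ℝ × ℝ, quadraticKernel ρ φ (y.1 - y.2)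
      ∂((volume.restrict (Set.Ioc 0 T)).prod (volume.restrict (Set.Ioc 0 T))) =
    (∫ x : ℝ × ℝ, (x.1 + x.2 - 2 * φ) ^ 2 * cosKernel T (x.1 - x.2) ∂(ρ.prod ρ)) / 4 := by
  simp only [quadraticKernel]
  rw [integral_div, integral_integral_swap]
  · simp only [integral_const_mul, cosKernel]
  · refine ((integrable_quadratic_prod hρ φ).comp_snd _).mul_bdd (c := 1)
      (Continuous.aestronglyMeasurable ?_) (.of_forall fun x => Real.abs_cos_le_one _)
    fun_prop

-- The weight is bounded below on pairs of frequencies close to a point `c ≠ φ` of the support,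
-- and the cosine kernel is of order `T²` on the strip `|x₁ - x₂| ≤ 1 / T`, whose mass is of
-- order `1 / T`.
theorem exists_linear_le_integral_quadraticKernel (hρ : MemLp (fun l : ℝ => l) 2 ρ)
    (hdeg : ¬ IsDegenerate ρ) (φ : ℝ) :
    ∃ C > 0, ∀ T : ℝ, 1 ≤ T → C * T ≤ ∫ y : ℝ × ℝ, quadraticKernel ρ φ (y.1 - y.2)
      ∂((volume.restrict (Set.Ioc 0 T)).prod (volume.restrict (Set.Ioc 0 T))) := by
  obtain ⟨c, hc, hcφ⟩ := exists_mem_support_ne hdeg φ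
  set d := |c - φ|
  have hd : 0 < d := abs_pos.2 (sub_ne_zero.2 hcφ)
  set A := Metric.closedBall c (d / 2)
  have hA : 0 < ρ.real A := measureReal_closedBall_pos_of_mem_support hc (half_pos hd)
  have hAIcc : A ⊆ Set.Icc (c - d / 2) (c - d / 2 + d) :=
    Real.closedBall_eq_Icc.subset.trans (Set.Icc_subset_Icc_right (by linarith))
  have hweight : ∀ x ∈ A, ∀ y ∈ A, d ^ 2 ≤ (x + y - 2 * φ) ^ 2 := fun x hx y hy => by
    rw [Metric.mem_closedBall, Real.dist_eq] at hx hy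
    have htri : 2 * d ≤ |x - c| + |y - c| + |x + y - 2 * φ| :=
      calc 2 * d = |(c - x) + (c - y) + (x + y - 2 * φ)| := by
            rw [show (c - x) + (c - y) + (x + y - 2 * φ) = 2 * (c - φ) by ring, abs_mul, abs_two]
        _ ≤ |c - x| + |c - y| + |x + y - 2 * φ| := abs_add_three _ _ _
        _ = _ := by rw [abs_sub_comm x, abs_sub_comm y]
    rw [sq_le_sq, abs_of_pos hd]
    linarith
  refine ⟨d ^ 2 * (ρ.real A ^ 2 / (d + 1)) / 16, by positivity, fun T hT => ?_⟩
  have hT0 : 0 < T := one_pos.trans_le hT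
  set D : Set (ℝ × ℝ) := {x | x.1 ∈ A ∧ x.2 ∈ A ∧ |x.1 - x.2| ≤ T⁻¹}
  have hD : MeasurableSet D :=
    (measurable_fst measurableSet_closedBall).inter <|
      (measurable_snd measurableSet_closedBall).inter <|
        measurableSet_le (f := fun x : ℝ × ℝ => |x.1 - x.2|) (by fun_prop) measurable_const
  have hlow := mul_measureReal_le_integral (integrable_quadratic_prod_mul_cosKernel hρ φ T)
    (fun x => mul_nonneg (sq_nonneg _) (cosKernel_nonneg _ _)) hD (c := d ^ 2 * (T ^ 2 / 4))
    fun x hx => mul_le_mul (hweight _ hx.1 _ hx.2.1) (sq_div_four_le_cosKernel hT0 hx.2.2)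
      (by positivity) (sq_nonneg _)
  rw [integral_quadraticKernel hρ]
  calc d ^ 2 * (ρ.real A ^ 2 / (d + 1)) / 16 * T
      = d ^ 2 * (T ^ 2 / 4) * (ρ.real A ^ 2 / ((d + 1) * T)) / 4 := by
        field_simp
        ring
    _ ≤ d ^ 2 * (T ^ 2 / 4) * (ρ.prod ρ).real D / 4 := by
        gcongr
        exact sq_measureReal_div_le_prod_near_diag measurableSet_closedBall hAIcc hd.le hT
    _ ≤ _ := by gcongr

end SpectralLowerBound

section SpectralIdentities

variable {ρ : Measure ℝ}

/-- The spectral representative of `f' + i φ f` at time `t`. -/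
noncomputable def spectralDeriv (φ t l : ℝ) : ℂ := -Complex.I * (l - φ) * spectralExp t l

theorem spectralExp_mul_conj (s t l : ℝ) :
    spectralExp s l * conj (spectralExp t l) = spectralExp (s - t) l := by
  rw [conj_spectralExp, ← spectralExp_add, sub_eq_add_neg]

theorem integral_norm_spectralExp_sq [IsProbabilityMeasure ρ] (t : ℝ) :
    ∫ l, ‖spectralExp t l‖ ^ 2 ∂ρ = 1 := by
  simp [norm_spectralExp]

theorem integral_norm_spectralDeriv_sq (φ t : ℝ) :
    ∫ l, ‖spectralDeriv φ t l‖ ^ 2 ∂ρ = ∫ l, (l - φ) ^ 2 ∂ρ := by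
  refine integral_congr_ae (.of_forall fun l => ?_)
  simp only [spectralDeriv, norm_mul, norm_spectralExp, norm_neg, Complex.norm_I, one_mul, mul_one]
  rw [← Complex.ofReal_sub, Complex.norm_real, Real.norm_eq_abs, sq_abs]

theorem integral_spectralExp_mul_conj_spectralDeriv_self [IsProbabilityMeasure ρ]
    (hρ : Integrable (fun l : ℝ => l) ρ) (t : ℝ) :
    ∫ l, spectralExp t l * conj (spectralDeriv (∫ l, l ∂ρ) t l) ∂ρ = 0 := by
  have h : ∀ l, spectralExp t l * conj (spectralDeriv (∫ l, l ∂ρ) t l) =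
      Complex.I * ((l - ∫ l, l ∂ρ : ℝ) : ℂ) := fun l => by
    simp only [spectralDeriv, map_mul, map_neg, Complex.conj_I, neg_neg]
    rw [mul_left_comm, spectralExp_mul_conj]
    simp [spectralExp]
  simp only [h]
  rw [integral_const_mul, integral_complex_ofReal, integral_sub hρ (integrable_const _)]
  simp

theorem re_integral_ofReal_mul_exp_mul_I {α : Type*} [MeasurableSpace α] {μ : Measure α}
    {g θ : α → ℝ} (hg : Integrable g μ) (hθ : Measurable θ) :
    (∫ x, (g x : ℂ) * Complex.exp (θ x * Complex.I) ∂μ).re = ∫ x, g x * Real.cos (θ x) ∂μ := by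
  have hint : Integrable (fun x => (g x : ℂ) * Complex.exp (θ x * Complex.I)) μ :=
    hg.ofReal.mul_bdd (c := 1) (by fun_prop) (.of_forall fun x => by
      rw [Complex.norm_exp_ofReal_mul_I])
  refine (integral_re hint).symm.trans (integral_congr_ae (.of_forall fun x => ?_))
  simp only [RCLike.re_eq_complex_re]
  rw [Complex.re_ofReal_mul, Complex.exp_ofReal_mul_I_re]

theorem spectralExp_mul_conj_mul (s t x y : ℝ) :
    spectralExp t x * conj (spectralExp s x) * (spectralExp s y * conj (spectralExp t y)) =
      Complex.exp (((x - y) * (s - t) : ℝ) * Complex.I) := by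
  rw [spectralExp_mul_conj, spectralExp_mul_conj, spectralExp, spectralExp, ← Complex.exp_add]
  push_cast
  ring_nf

theorem integral_spectralExp_mul_conj_mul_integral_spectralDeriv_mul_conj [SFinite ρ]
    (φ s t : ℝ) :
    (∫ l, spectralExp t l * conj (spectralExp s l) ∂ρ) *
        (∫ l, spectralDeriv φ s l * conj (spectralDeriv φ t l) ∂ρ) =
      ∫ x : ℝ × ℝ, (((x.2 - φ) ^ 2 : ℝ) : ℂ) *
        Complex.exp (((x.1 - x.2) * (s - t) : ℝ) * Complex.I) ∂(ρ.prod ρ) := by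
  rw [← integral_prod_mul]
  refine integral_congr_ae (.of_forall fun x => ?_)
  simp only [← spectralExp_mul_conj_mul, spectralDeriv, map_mul, map_neg, Complex.conj_I, map_sub,
    Complex.conj_ofReal]
  push_cast
  linear_combination (-(x.2 - φ : ℂ) ^ 2 * (spectralExp t x.1 * conj (spectralExp s x.1) *
    (spectralExp s x.2 * conj (spectralExp t x.2)))) * Complex.I_sq

theorem integral_spectralDeriv_mul_conj_spectralExp_mul_integral [SFinite ρ] (φ s t : ℝ) :
    (∫ l, spectralDeriv φ t l * conj (spectralExp s l) ∂ρ) *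
        (∫ l, spectralDeriv φ s l * conj (spectralExp t l) ∂ρ) =
      ∫ x : ℝ × ℝ, ((-((x.1 - φ) * (x.2 - φ)) : ℝ) : ℂ) *
        Complex.exp (((x.1 - x.2) * (s - t) : ℝ) * Complex.I) ∂(ρ.prod ρ) := by
  rw [← integral_prod_mul]
  refine integral_congr_ae (.of_forall fun x => ?_)
  simp only [← spectralExp_mul_conj_mul, spectralDeriv]
  push_cast
  linear_combination ((x.1 - φ : ℂ) * (x.2 - φ) * (spectralExp t x.1 * conj (spectralExp s x.1) *
    (spectralExp s x.2 * conj (spectralExp t x.2)))) * Complex.I_sq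

variable [IsProbabilityMeasure ρ]

theorem integrable_mul_cos {α : Type*} [MeasurableSpace α] {μ : Measure α} {g θ : α → ℝ}
    (hg : Integrable g μ) (hθ : Measurable θ) :
    Integrable (fun x => g x * Real.cos (θ x)) μ :=
  hg.mul_bdd (c := 1) (by fun_prop) (.of_forall fun x => Real.abs_cos_le_one _)

theorem two_mul_integral_prod_mul_cos {g : ℝ × ℝ → ℝ} (hg : Integrable g (ρ.prod ρ)) (τ : ℝ) :
    2 * ∫ x : ℝ × ℝ, g x * Real.cos ((x.1 - x.2) * τ) ∂(ρ.prod ρ) =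
      ∫ x : ℝ × ℝ, (g x + g x.swap) * Real.cos ((x.1 - x.2) * τ) ∂(ρ.prod ρ) := by
  have hswap : ∫ x : ℝ × ℝ, g x.swap * Real.cos ((x.1 - x.2) * τ) ∂(ρ.prod ρ) =
      ∫ x : ℝ × ℝ, g x * Real.cos ((x.1 - x.2) * τ) ∂(ρ.prod ρ) := by
    rw [← integral_prod_swap]
    refine integral_congr_ae (.of_forall fun x => ?_)
    simp only [Prod.swap_swap, Prod.fst_swap, Prod.snd_swap]
    rw [← Real.cos_neg, ← neg_mul, neg_sub]
  have hg' : Integrable (fun x => g x.swap) (ρ.prod ρ) := hg.swap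
  simp only [add_mul]
  rw [integral_add (integrable_mul_cos hg (by fun_prop))
    (integrable_mul_cos hg' (by fun_prop)), hswap, two_mul]

theorem quadraticKernel_eq (hρ : MemLp (fun l : ℝ => l) 2 ρ) (φ s t : ℝ) :
    ((∫ l, spectralExp t l * conj (spectralExp s l) ∂ρ) *
        (∫ l, spectralDeriv φ s l * conj (spectralDeriv φ t l) ∂ρ) -
      (∫ l, spectralDeriv φ t l * conj (spectralExp s l) ∂ρ) *
        ∫ l, spectralDeriv φ s l * conj (spectralExp t l) ∂ρ).re / 2 =
      quadraticKernel ρ φ (s - t) := by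
  have hfst : MemLp (fun x : ℝ × ℝ => x.1 - φ) 2 (ρ.prod ρ) :=
    (hρ.comp_fst ρ).sub (memLp_const φ)
  have hsnd : MemLp (fun x : ℝ × ℝ => x.2 - φ) 2 (ρ.prod ρ) :=
    (hρ.comp_snd ρ).sub (memLp_const φ)
  have hsq : Integrable (fun x : ℝ × ℝ => (x.2 - φ) ^ 2) (ρ.prod ρ) := hsnd.integrable_sq
  have hmul : Integrable (fun x : ℝ × ℝ => -((x.1 - φ) * (x.2 - φ))) (ρ.prod ρ) :=
    (hfst.integrable_mul hsnd).neg
  rw [integral_spectralExp_mul_conj_mul_integral_spectralDeriv_mul_conj,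
    integral_spectralDeriv_mul_conj_spectralExp_mul_integral, Complex.sub_re,
    re_integral_ofReal_mul_exp_mul_I hsq (by fun_prop),
    re_integral_ofReal_mul_exp_mul_I hmul (by fun_prop),
    ← integral_sub (integrable_mul_cos hsq (by fun_prop)) (integrable_mul_cos hmul (by fun_prop))]
  simp only [← sub_mul]
  have hsymm := two_mul_integral_prod_mul_cos (hsq.sub hmul) (s - t)
  simp only [Pi.sub_apply, Prod.fst_swap, Prod.snd_swap] at hsymm
  rw [quadraticKernel, ← mul_div_mul_left _ (2 : ℝ) two_ne_zero, hsymm]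
  congr 1
  · refine integral_congr_ae (.of_forall fun x => ?_)
    ring
  · norm_num

end SpectralIdentities

theorem integral_mul_self_le_variance {Ω : Type*} [MeasurableSpace Ω] {P : Measure Ω}
    [IsProbabilityMeasure P] {D Q : Ω → ℝ} (hD : MemLp D 2 P) (hQ : MemLp Q 2 P)
    (hQ0 : ∫ ω, Q ω ∂P = 0) (hDQ : ∫ ω, D ω * Q ω ∂P = ∫ ω, Q ω * Q ω ∂P) :
    ∫ ω, Q ω * Q ω ∂P ≤ Var[D; P] := by
  have hcov : cov[D, Q; P] = ∫ ω, Q ω * Q ω ∂P := by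
    rw [covariance_eq_sub hD hQ, hQ0, mul_zero, sub_zero]
    exact hDQ
  have hvar : Var[Q; P] = ∫ ω, Q ω * Q ω ∂P := by
    rw [variance_of_integral_eq_zero hQ.aemeasurable hQ0]
    simp only [sq]
  have hsub := variance_nonneg (D - Q) P
  rw [variance_sub hD hQ, hcov, hvar] at hsub
  linarith

section Winding

variable {Ω : Type*} {f : ℝ → Ω → ℂ}

/-- The derivative of the demodulated process `t ↦ exp (i φ t) f t`, up to the phase factor
`exp (i φ t)`. -/
noncomputable def centredDeriv (f : ℝ → Ω → ℂ) (φ t : ℝ) (ω : Ω) : ℂ :=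
  deriv (fun s => f s ω) t + Complex.I * φ * f t ω

/-- The instantaneous angular velocity of the path, whose time integral is the winding. -/
noncomputable def angularVelocity (f : ℝ → Ω → ℂ) (t : ℝ) (ω : Ω) : ℝ :=
  (deriv (fun s => f s ω) t / f t ω).im

/-- The angular velocity of the path demodulated at frequency `φ`, with `1 / f` replaced by the
conjugate of `f`: a quadratic functional of the process with which the angular velocity is
correlated. -/
noncomputable def quadraticVelocity (f : ℝ → Ω → ℂ) (φ t : ℝ) (ω : Ω) : ℝ :=
  (conj (f t ω) * centredDeriv f φ t ω).im

theorem winding_eq_integral_angularVelocity {T : ℝ} (hT : 0 ≤ T) (ω : Ω) :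
    winding (fun t => f t ω) T = ∫ s in Set.Ioc 0 T, angularVelocity f s ω :=
  intervalIntegral.integral_of_le hT

variable [MeasurableSpace Ω] {P : Measure Ω}

theorem measurable_angularVelocity (hm : ∀ t, Measurable (f t))
    (hd : ∀ ω, ContDiff ℝ 1 (fun t => f t ω)) :
    Measurable (Function.uncurry (angularVelocity f)) :=
  Complex.measurable_im.comp <| (measurable_uncurry_deriv hm hd).div <|
    measurable_uncurry_of_continuous_of_measurable (fun ω => (hd ω).continuous) hm

theorem measurable_quadraticVelocity (hm : ∀ t, Measurable (f t))
    (hd : ∀ ω, ContDiff ℝ 1 (fun t => f t ω)) (φ : ℝ) :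
    Measurable (Function.uncurry (quadraticVelocity f φ)) := by
  have hf := measurable_uncurry_of_continuous_of_measurable (fun ω => (hd ω).continuous) hm
  exact Complex.measurable_im.comp ((Complex.continuous_conj.measurable.comp hf).mul
    ((measurable_uncurry_deriv hm hd).add (hf.const_mul _)))

theorem centredDeriv_mem_aeSeqClosure {t : ℝ}
    (hd : ∀ᵐ ω ∂P, DifferentiableAt ℝ (fun s => f s ω) t) (φ : ℝ) :
    (centredDeriv f φ t, spectralDeriv φ t) ∈ aeSeqClosure P (processSpan f) := by
  convert add_mem (deriv_mem_aeSeqClosure hd)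
    (Submodule.smul_mem _ (Complex.I * φ) (le_aeSeqClosure (mem_processSpan f t))) using 1
  refine Prod.ext (funext fun ω => ?_) (funext fun l => ?_)
  · simp [centredDeriv]
  · simp only [spectralDeriv, Prod.snd_add, Prod.smul_snd, Pi.add_apply, Pi.smul_apply,
      smul_eq_mul]
    ring

variable [IsProbabilityMeasure P] {ρ : Measure ℝ}

theorem memLp_quadraticVelocity (hS : IsIsonormal P ρ (processSpan f))
    (hd : ∀ᵐ ω ∂P, Differentiable ℝ (fun t => f t ω)) (φ t : ℝ) :
    MemLp (quadraticVelocity f φ t) 2 P := by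
  have hz : MemLp (f t) 4 P :=
    hS.aeSeqClosure.memLp_fst (le_aeSeqClosure (mem_processSpan f t)) (by simp)
  have hw : MemLp (centredDeriv f φ t) 4 P :=
    hS.aeSeqClosure.memLp_fst (centredDeriv_mem_aeSeqClosure (hd.mono fun ω h => h t) φ) (by simp)
  exact (memLp_two_mul_of_memLp_four hz.star hw).im

variable [IsProbabilityMeasure ρ]

theorem integral_quadraticVelocity (hS : IsIsonormal P ρ (processSpan f))
    (hd : ∀ᵐ ω ∂P, Differentiable ℝ (fun t => f t ω)) (t : ℝ) :
    ∫ ω, quadraticVelocity f (∫ l, l ∂ρ) t ω ∂P = 0 := by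
  have hC := hS.aeSeqClosure
  have hz := le_aeSeqClosure (P := P) (mem_processSpan f t)
  have hw := centredDeriv_mem_aeSeqClosure (hd.mono fun ω h => h t) (∫ l, l ∂ρ)
  have hρ := hS.memLp_id_of_ae_differentiableAt (hd.mono fun ω h => h t)
  have hzw : ∫ ω, f t ω * conj (centredDeriv f (∫ l, l ∂ρ) t ω) ∂P = 0 :=
    (hC.integral_mul_conj hz hw).trans
      (integral_spectralExp_mul_conj_spectralDeriv_self (hρ.integrable one_le_two) t)
  have hint : Integrable (fun ω => f t ω * conj (centredDeriv f (∫ l, l ∂ρ) t ω)) P :=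
    integrable_mul_conj (hC.memLp_fst hz (by simp)) (hC.memLp_fst hw (by simp))
  have him : ∀ ω, quadraticVelocity f (∫ l, l ∂ρ) t ω =
      -(f t ω * conj (centredDeriv f (∫ l, l ∂ρ) t ω)).im := fun ω => by
    rw [quadraticVelocity, ← Complex.conj_im, map_mul, Complex.conj_conj]
  simp only [him]
  rw [integral_neg, neg_eq_zero]
  exact (integral_im hint).trans (congrArg Complex.im hzw)

theorem integral_im_dualFactor_mul_quadraticVelocity (hS : IsIsonormal P ρ (processSpan f))
    (hd : ∀ᵐ ω ∂P, Differentiable ℝ (fun t => f t ω)) {N : ℂ → ℂ} (hN : IsDualFactor N)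
    (s t : ℝ) :
    Integrable (fun ω => (N (f s ω) * centredDeriv f (∫ l, l ∂ρ) s ω).im *
        quadraticVelocity f (∫ l, l ∂ρ) t ω) P ∧
    ∫ ω, (N (f s ω) * centredDeriv f (∫ l, l ∂ρ) s ω).im *
        quadraticVelocity f (∫ l, l ∂ρ) t ω ∂P =
      quadraticKernel ρ (∫ l, l ∂ρ) (s - t) := by
  have hρ := hS.memLp_id_of_ae_differentiableAt (hd.mono fun ω h => h s)
  have hz := fun u => le_aeSeqClosure (P := P) (mem_processSpan f u)
  have hw := fun u => centredDeriv_mem_aeSeqClosure (hd.mono fun ω h => h u) (∫ l, l ∂ρ)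
  have h := hS.aeSeqClosure.integral_im_dualFactor_mul_im hN (hz s) (hw s) (hz t) (hw t)
    (integral_norm_spectralExp_sq s)
    (integral_spectralExp_mul_conj_spectralDeriv_self (hρ.integrable one_le_two) s)
  rw [quadraticKernel_eq hρ] at h
  simpa only [quadraticVelocity, mul_comm (conj (f t _))] using h

theorem integral_quadraticVelocity_mul (hS : IsIsonormal P ρ (processSpan f))
    (hd : ∀ᵐ ω ∂P, Differentiable ℝ (fun t => f t ω)) (s t : ℝ) :
    ∫ ω, quadraticVelocity f (∫ l, l ∂ρ) s ω * quadraticVelocity f (∫ l, l ∂ρ) t ω ∂P =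
      quadraticKernel ρ (∫ l, l ∂ρ) (s - t) :=
  (integral_im_dualFactor_mul_quadraticVelocity hS hd isDualFactor_conj s t).2

theorem integral_angularVelocity_mul (hS : IsIsonormal P ρ (processSpan f))
    (hd : ∀ᵐ ω ∂P, Differentiable ℝ (fun t => f t ω)) (s t : ℝ) :
    ∫ ω, angularVelocity f s ω * quadraticVelocity f (∫ l, l ∂ρ) t ω ∂P =
      quadraticKernel ρ (∫ l, l ∂ρ) (s - t) := by
  set φ := ∫ l, l ∂ρ
  have hne : ∀ᵐ ω ∂P, f s ω ≠ 0 :=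
    hS.ae_ne_zero (mem_processSpan f s) (by simp [integral_norm_spectralExp_sq])
  have hshift : (fun ω => angularVelocity f s ω * quadraticVelocity f φ t ω) =ᵐ[P] fun ω =>
      ((f s ω)⁻¹ * centredDeriv f φ s ω).im * quadraticVelocity f φ t ω -
        φ * quadraticVelocity f φ t ω := by
    filter_upwards [hne] with ω hω
    have hdemod : (f s ω)⁻¹ * centredDeriv f φ s ω =
        deriv (fun u => f u ω) s / f s ω + Complex.I * φ := by
      rw [centredDeriv]
      field_simp
    rw [hdemod, Complex.add_im, Complex.im_mul_ofReal, Complex.I_im, angularVelocity]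
    ring
  have hwick := integral_im_dualFactor_mul_quadraticVelocity hS hd isDualFactor_inv s t
  rw [integral_congr_ae hshift, integral_sub hwick.1
    (((memLp_quadraticVelocity hS hd φ t).integrable one_le_two).const_mul φ), hwick.2,
    integral_const_mul, integral_quadraticVelocity hS hd, mul_zero, sub_zero]

theorem lintegral_enorm_quadraticVelocity_mul_le (hS : IsIsonormal P ρ (processSpan f))
    (hd : ∀ᵐ ω ∂P, Differentiable ℝ (fun t => f t ω)) (s t : ℝ) :
    ∫⁻ ω, ‖quadraticVelocity f (∫ l, l ∂ρ) s ω‖ₑ * ‖quadraticVelocity f (∫ l, l ∂ρ) t ω‖ₑ ∂P ≤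
      2 * ENNReal.ofReal (quadraticKernel ρ (∫ l, l ∂ρ) 0) := by
  have hQ := memLp_quadraticVelocity hS hd (∫ l, l ∂ρ)
  have hsq : ∀ u, ∫⁻ ω, ‖quadraticVelocity f (∫ l, l ∂ρ) u ω‖ₑ ^ 2 ∂P =
      ENNReal.ofReal (quadraticKernel ρ (∫ l, l ∂ρ) 0) := fun u => by
    rw [← sub_self u, ← integral_quadraticVelocity_mul hS hd u u]
    simp only [← sq]
    rw [ofReal_integral_eq_lintegral_ofReal (hQ u).integrable_sq (.of_forall fun ω => sq_nonneg _)]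
    refine lintegral_congr fun ω => ?_
    rw [← enorm_pow, Real.enorm_of_nonneg (sq_nonneg _)]
  calc _ ≤ ∫⁻ ω, (‖quadraticVelocity f (∫ l, l ∂ρ) s ω‖ₑ ^ 2 +
          ‖quadraticVelocity f (∫ l, l ∂ρ) t ω‖ₑ ^ 2) ∂P :=
        lintegral_mono fun ω => mul_le_sq_add_sq _ _
    _ = _ := by
        rw [lintegral_add_left' ((hQ s).aestronglyMeasurable.enorm.pow_const 2), hsq, hsq, two_mul]

theorem lintegral_enorm_angularVelocity_mul_le (hS : IsIsonormal P ρ (processSpan f))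
    (hd : ∀ᵐ ω ∂P, Differentiable ℝ (fun t => f t ω)) {s t β : ℝ} (hβ : 0 < β)
    (hβst : β ^ 2 ≤ 1 - ‖∫ l, spectralExp (t - s) l ∂ρ‖ ^ 2) :
    ∫⁻ ω, ‖angularVelocity f s ω‖ₑ * ‖angularVelocity f t ω‖ₑ ∂P ≤
      ENNReal.ofReal (2 * (√(∫ l, l ^ 2 ∂ρ) ^ (12 : ℝ) * Real.Gamma 7) +
        4 * (Real.Gamma (7 / 10) * Real.Gamma (1 / 10)) * β ^ (-(3 / 5) : ℝ)) := by
  have hz := fun u => le_aeSeqClosure (P := P) (mem_processSpan f u)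
  have hw := fun u => centredDeriv_mem_aeSeqClosure (hd.mono fun ω h => h u) 0
  have hle : ∀ u ω, ‖angularVelocity f u ω‖ₑ ≤ ‖centredDeriv f 0 u ω / f u ω‖ₑ := fun u ω => by
    rw [enorm_le_iff_norm_le]
    simpa [angularVelocity, centredDeriv] using
      Complex.abs_im_le_norm (deriv (fun s => f s ω) u / f u ω)
  refine (lintegral_mono fun ω => mul_le_mul' (hle s ω) (hle t ω)).trans ?_
  exact hS.aeSeqClosure.lintegral_two_point_le (hz s) (hz t) (hw s) (hw t)
    (integral_norm_spectralExp_sq s) (integral_norm_spectralExp_sq t)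
    (by simpa only [sub_zero] using integral_norm_spectralDeriv_sq 0 s)
    (by simpa only [sub_zero] using integral_norm_spectralDeriv_sq 0 t) hβ
    (by simpa only [spectralExp_mul_conj] using hβst)

theorem lintegral_sq_angularVelocity_lt_top (hS : IsIsonormal P ρ (processSpan f))
    (hdeg : ¬ IsDegenerate ρ) (hm : ∀ t, Measurable (f t))
    (hd : ∀ ω, ContDiff ℝ 1 (fun t => f t ω)) (T : ℝ) :
    ∫⁻ ω, (∫⁻ s in Set.Ioc 0 T, ‖angularVelocity f s ω‖ₑ) ^ 2 ∂P < ⊤ := by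
  obtain ⟨κ, hκ, τ, hτ, hκτ⟩ := exists_mul_sq_le_one_sub_norm_integral_spectralExp_sq hdeg
  have hκ' : 0 < √κ := Real.sqrt_pos.2 hκ
  set A := 2 * (√(∫ l, l ^ 2 ∂ρ) ^ (12 : ℝ) * Real.Gamma 7)
  set B := 4 * (Real.Gamma (7 / 10) * Real.Gamma (1 / 10))
  have hint : IntegrableOn (fun u => A + B * (√κ * |u|) ^ (-(3 / 5) : ℝ))
      (Set.Icc (-τ) τ) := by
    simp only [Real.mul_rpow hκ'.le (abs_nonneg _)]
    exact (integrable_const A).add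
      (((integrableOn_abs_rpow τ (by norm_num)).const_mul _).const_mul B)
  have hbound : ∀ s t, s ≠ t → |s - t| ≤ τ →
      ∫⁻ ω, ‖angularVelocity f s ω‖ₑ * ‖angularVelocity f t ω‖ₑ ∂P ≤
        ENNReal.ofReal (A + B * (√κ * |s - t|) ^ (-(3 / 5) : ℝ)) := fun s t hst hstτ => by
    refine lintegral_enorm_angularVelocity_mul_le hS
      (.of_forall fun ω => (hd ω).differentiable one_ne_zero)
      (mul_pos hκ' (abs_pos.2 (sub_ne_zero.2 hst))) ?_
    rw [mul_pow, Real.sq_sqrt hκ.le, sq_abs, sub_sq_comm]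
    exact hκτ (t - s) (by rwa [abs_sub_comm])
  refine (lintegral_mono fun ω => ?_).trans_lt <| lintegral_sq_setLIntegral_lt_top hτ
    (measurable_angularVelocity hm hd).enorm (by fun_prop) hint.lintegral_lt_top hbound
    (isCompact_Icc (a := 0) (b := T))
  gcongr
  exact Set.Ioc_subset_Icc_self

theorem lintegral_sq_quadraticVelocity_lt_top (hS : IsIsonormal P ρ (processSpan f))
    (hm : ∀ t, Measurable (f t)) (hd : ∀ ω, ContDiff ℝ 1 (fun t => f t ω)) (T : ℝ) :
    ∫⁻ ω, (∫⁻ s in Set.Ioc 0 T, ‖quadraticVelocity f (∫ l, l ∂ρ) s ω‖ₑ) ^ 2 ∂P < ⊤ := by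
  have hd' : ∀ᵐ ω ∂P, Differentiable ℝ (fun t => f t ω) :=
    .of_forall fun ω => (hd ω).differentiable one_ne_zero
  refine (lintegral_mono fun ω => ?_).trans_lt <| lintegral_sq_setLIntegral_lt_top one_pos
    (measurable_quadraticVelocity hm hd _).enorm
    (G := fun _ => 2 * ENNReal.ofReal (quadraticKernel ρ (∫ l, l ∂ρ) 0)) measurable_const
    (by simp [ENNReal.mul_lt_top])
    (fun s t _ _ => lintegral_enorm_quadraticVelocity_mul_le hS hd' s t)
    (isCompact_Icc (a := 0) (b := T))
  gcongr
  exact Set.Ioc_subset_Icc_self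

theorem memLp_two_winding (hS : IsIsonormal P ρ (processSpan f))
    (hdeg : ¬ IsDegenerate ρ) (hm : ∀ t, Measurable (f t))
    (hd : ∀ ω, ContDiff ℝ 1 (fun t => f t ω)) {T : ℝ} (hT : 0 ≤ T) :
    MemLp (fun ω => winding (fun t => f t ω) T) 2 P := by
  simp only [winding_eq_integral_angularVelocity hT]
  exact memLp_two_integral (measurable_angularVelocity hm hd)
    (lintegral_sq_angularVelocity_lt_top hS hdeg hm hd T)

theorem integral_integral_quadraticVelocity (hS : IsIsonormal P ρ (processSpan f))
    (hm : ∀ t, Measurable (f t)) (hd : ∀ ω, ContDiff ℝ 1 (fun t => f t ω)) {T : ℝ} (hT : 0 < T) :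
    ∫ ω, (∫ s in Set.Ioc 0 T, quadraticVelocity f (∫ l, l ∂ρ) s ω) ∂P = 0 := by
  have hd' : ∀ᵐ ω ∂P, Differentiable ℝ (fun t => f t ω) :=
    .of_forall fun ω => (hd ω).differentiable one_ne_zero
  have hone := integral_integral_mul_integral (P := P) (μ := volume.restrict (Set.Ioc 0 T))
    (X := fun _ _ => (1 : ℝ)) (by fun_prop) (measurable_quadraticVelocity hm hd (∫ l, l ∂ρ))
    (by simp) (lintegral_sq_quadraticVelocity_lt_top hS hm hd T)
  simpa [integral_const_mul, integral_quadraticVelocity hS hd', hT.le, hT.ne'] using hone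

theorem integral_quadraticKernel_le_variance_winding (hS : IsIsonormal P ρ (processSpan f))
    (hdeg : ¬ IsDegenerate ρ) (hm : ∀ t, Measurable (f t))
    (hd : ∀ ω, ContDiff ℝ 1 (fun t => f t ω)) {T : ℝ} (hT : 0 < T) :
    ∫ y : ℝ × ℝ, quadraticKernel ρ (∫ l, l ∂ρ) (y.1 - y.2)
        ∂((volume.restrict (Set.Ioc 0 T)).prod (volume.restrict (Set.Ioc 0 T))) ≤
      Var[fun ω => winding (fun t => f t ω) T; P] := by
  have hd' : ∀ᵐ ω ∂P, Differentiable ℝ (fun t => f t ω) :=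
    .of_forall fun ω => (hd ω).differentiable one_ne_zero
  have hXm := measurable_angularVelocity hm hd
  have hX := lintegral_sq_angularVelocity_lt_top hS hdeg hm hd T
  have hYm := measurable_quadraticVelocity hm hd (∫ l, l ∂ρ)
  have hY := lintegral_sq_quadraticVelocity_lt_top hS hm hd T
  have hXY := integral_integral_mul_integral hXm hYm hX hY
  have hYY := integral_integral_mul_integral hYm hYm hY hY
  simp only [integral_angularVelocity_mul hS hd'] at hXY
  simp only [integral_quadraticVelocity_mul hS hd'] at hYY
  simp only [winding_eq_integral_angularVelocity hT.le]
  exact hYY.ge.trans <| integral_mul_self_le_variance (memLp_two_integral hXm hX)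
    (memLp_two_integral hYm hY) (integral_integral_quadraticVelocity hS hm hd hT)
    (hXY.trans hYY.symm)

end Winding

theorem covarianceKernel_congr {Ω : Type*} [MeasurableSpace Ω] {P : Measure Ω}
    {f g : ℝ → Ω → ℂ} (hfg : ∀ᵐ ω ∂P, ∀ t, f t ω = g t ω) (t : ℝ) :
    covarianceKernel f P t = covarianceKernel g P t :=
  integral_congr_ae (hfg.mono fun ω hω => by simp only [hω])

theorem memLp_two_winding_and_integral_quadraticKernel_le {Ω : Type*} [MeasurableSpace Ω]
    {P : Measure Ω} [IsProbabilityMeasure P] {f : ℝ → Ω → ℂ} {r : ℝ → ℂ} {ρ : Measure ℝ}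
    (hf : IsGSP f P) (hρ : IsSpectralMeasure r ρ) (hr : ∀ t, covarianceKernel f P t = r t)
    (hdeg : ¬ IsDegenerate ρ) (hd : ∀ᵐ ω ∂P, ContDiff ℝ 1 (fun t => f t ω))
    {T : ℝ} (hT : 0 < T) :
    MemLp (fun ω => winding (fun t => f t ω) T) 2 P ∧
      ∫ y : ℝ × ℝ, quadraticKernel ρ (∫ l, l ∂ρ) (y.1 - y.2)
          ∂((volume.restrict (Set.Ioc 0 T)).prod (volume.restrict (Set.Ioc 0 T))) ≤
        Var[fun ω => winding (fun t => f t ω) T; P] := by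
  have := hρ.1
  obtain ⟨g, hgm, hgd, hfg⟩ := exists_measurable_contDiff_modification hf.aemeasurable hd
  have hS := (hf.congr hfg).isIsonormal_processSpan hρ fun t =>
    (covarianceKernel_congr hfg t).symm.trans (hr t)
  have hwinding : (fun ω => winding (fun t => g t ω) T) =ᵐ[P]
      fun ω => winding (fun t => f t ω) T :=
    hfg.mono fun ω hω => by simp only [hω]
  rw [← memLp_congr_ae hwinding, ← variance_congr hwinding]
  exact ⟨memLp_two_winding hS hdeg hgm hgd hT.le,
    integral_quadraticKernel_le_variance_winding hS hdeg hgm hgd hT⟩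

theorem theorem1p2_general (r : ℝ → ℂ) (ρ : Measure ℝ) (hρ : IsSpectralMeasure r ρ)
    (hdeg : ¬ IsDegenerate ρ) :
    ∃ C : ℝ, 0 < C ∧ ∃ T₀ : ℝ, 0 < T₀ ∧
      ∀ (Ω : Type*) [MeasurableSpace Ω] (P : Measure Ω) [IsProbabilityMeasure P]
        (f : ℝ → Ω → ℂ),
        IsGSP f P →
        (∀ t : ℝ, covarianceKernel f P t = r t) →
        (∀ᵐ ω ∂P, ContDiff ℝ 1 (fun t : ℝ => f t ω)) →
        ∀ T : ℝ, T₀ ≤ T →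
          MemLp (fun ω => winding (fun t : ℝ => f t ω) T) 2 P ∧
          C * T ≤ variance (fun ω => winding (fun t : ℝ => f t ω) T) P := by
  have := hρ.1
  by_cases hL : MemLp (fun l : ℝ => l) 2 ρ
  · obtain ⟨C, hC, hCT⟩ := exists_linear_le_integral_quadraticKernel hL hdeg (∫ l, l ∂ρ)
    refine ⟨C, hC, 1, one_pos, fun Ω _ P _ f hf hr hd T hT => ?_⟩
    obtain ⟨hmem, hvar⟩ := memLp_two_winding_and_integral_quadraticKernel_le hf hρ hr hdeg hd
      (one_pos.trans_le hT)
    exact ⟨hmem, (hCT T hT).trans hvar⟩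
  · refine ⟨1, one_pos, 1, one_pos, fun Ω _ P _ f hf hr hd => absurd ?_ hL⟩
    exact (hf.isIsonormal_processSpan hρ hr).memLp_id_of_ae_differentiableAt (t := 0)
      (hd.mono fun ω h => h.differentiable one_ne_zero 0)

theorem theorem1p2 (r : ℝ → ℂ) (ρ : Measure ℝ) (hρ : IsSpectralMeasure r ρ)
    (hlog : LogMomentCondition ρ) (hdeg : ¬ IsDegenerate ρ) :
    ∃ C : ℝ, 0 < C ∧ ∃ T₀ : ℝ, 0 < T₀ ∧
      ∀ (Ω : Type*) [MeasurableSpace Ω] (P : Measure Ω) [IsProbabilityMeasure P]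
        (f : ℝ → Ω → ℂ),
        IsGSP f P →
        (∀ t : ℝ, covarianceKernel f P t = r t) →
        (∀ᵐ ω ∂P, ContDiff ℝ 1 (fun t : ℝ => f t ω)) →
        ∀ T : ℝ, T₀ ≤ T →
          MemLp (fun ω => winding (fun t : ℝ => f t ω) T) 2 P ∧
          C * T ≤ variance (fun ω => winding (fun t : ℝ => f t ω) T) P :=
  theorem1p2_general r ρ hρ hdeg
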